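/- Let $d\ge 1$. Call a smooth, integrable function $g\colon[0,\infty)\to(0,\infty)$ a generator if $\frac{\pi^{d/2}}{\Gamma(d/2)}\int_0^\infty r^{d/2-1}g(r)\,dr=1$, $\int_0^\infty r^{(d-1)/2}g(r)\,dr<\infty$ and $\int_0^\infty r^{d/2}g(r)\,dr<\infty$. For $m\in\mathbb R^d$ and a symmetric positive definite $\Sigma\in\mathbb R^{d\times d}$, write $\mu\sim E(m,\Sigma,g)$ if $\mu$ has Lebesgue density $p_{m,\Sigma,g}(x)=\det(\Sigma)^{-1/2}g\big((x-m)^{T}\Sigma^{-1}(x-m)\big)$, and put $\kappa_g=\frac1d\int_{\mathbb R^d}\|y\|^2g(\|y\|^2)\,dy$. For $\mu,\nu$ in the elliptic family with generator $g$, a (Wasserstein) dual geodesic from $\mu$ to $\nu$ in this family is a curve $\rho_t=p_{m_t,\Sigma_t,g}$, $t\in[0,1]$, with $m_t\in\mathbb R^d$ and $\Sigma_t$ (symmetric positive definite) depending smoothly on $t$, such that $\rho_0,\rho_1$ are the densities of $\mu,\nu$ and there is a time-independent potential $f\in C^\infty(\mathbb R^d)$ with $\partial_t\rho_t=-\nabla\cdot(\rho_t\nabla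 f)$ on $[0,1]\times\mathbb R^d$. The WKL divergence is $$D^{\mathrm{WKL}}(\mu\mid\nu)=\inf\int_0^1 t\int_{\mathbb R^d}\|\nabla f(x)\|^2\rho_t(x)\,dx\,dt\in[0,\infty],$$ the infimum being taken over all such dual geodesics $\rho$ and potentials $f$. Theorem. Let $\mu\sim E(m_0,\Sigma_0,g)$, $\nu\sim E(m_1,\Sigma_1,g)$ and $\Delta m=m_1-m_0$. For a symmetric matrix $A$ let $A^\dagger$ be its Moore–Penrose inverse and $A^\perp=I-AA^\dagger$ the orthogonal projection onto its kernel; $\log$ and $\sqrt{\cdot}$ are the usual functions of symmetric positive (semi)definite matrices. Set $$R=\Sigma_0^{-1/2}\big(\Sigma_0^{1/2}\Sigma_1\Sigma_0^{1/2}\big)^{1/2}\Sigma_0^{-1/2},\qquad Q=(R-I)^\dagger\big(\log(R^2)R^2-R^2+I\big)(R-I)^\dagger .$$ Then $D^{\mathrm{WKL}}(\mu\mid\nu)$ is finite and $$D^{\mathrm{WKL}}(\mu\mid\nu)=\frac{\kappa_g}{4}\operatorname{tr}\big(\Sigma_0-\Sigma_1+\Sigma_0R^2\log(R^2)\big)+\frac14\Big\|\sqrt{Q+2\log(R)^\perp}\,\Delta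 m\Big\|^2 .$$ If moreover $\Sigma_0\Sigma_1=\Sigma_1\Sigma_0$, then $$D^{\mathrm{WKL}}(\mu\mid\nu)=\frac{\kappa_g}{4}\Big\|\sqrt{Q}\big(\sqrt{\Sigma_1}-\sqrt{\Sigma_0}\big)\Big\|_F^2+\frac14\Big\|\sqrt{Q+2\log(R)^\perp}\,\Delta m\Big\|^2 .$$ -/

import Mathlib

open MeasureTheory
open scoped ENNReal ContDiff Gradient Matrix

noncomputable section

namespace WKL

/-! ### Matrix functions -/

/-- Square root of a symmetric positive semidefinite matrix. -/
def sqrtm {d : ℕ} (A : Matrix (Fin d) (Fin d) ℝ) : Matrix (Fin d) (Fin d) ℝ :=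
  cfc Real.sqrt A

/-- Principal logarithm of a symmetric positive definite matrix. -/
def logm {d : ℕ} (A : Matrix (Fin d) (Fin d) ℝ) : Matrix (Fin d) (Fin d) ℝ :=
  cfc Real.log A

/-- Moore–Penrose pseudo-inverse of a symmetric matrix: nonzero eigenvalues are inverted and the
eigenvalue zero is kept (recall `0⁻¹ = 0`). See `pinv_penrose`. -/
def pinv {d : ℕ} (A : Matrix (Fin d) (Fin d) ℝ) : Matrix (Fin d) (Fin d) ℝ :=
  cfc (fun x : ℝ => x⁻¹) A

/-- The four Penrose equations, which characterize the Moore–Penrose inverse. -/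
theorem pinv_penrose {d : ℕ} (A : Matrix (Fin d) (Fin d) ℝ) (hA : A.IsHermitian) :
    A * pinv A * A = A ∧ pinv A * A * pinv A = pinv A ∧
      (A * pinv A)ᵀ = A * pinv A ∧ (pinv A * A)ᵀ = pinv A * A := by
  have hs : IsSelfAdjoint A := hA
  have hfin : (spectrum ℝ A).Finite := A.finite_real_spectrum
  have hc : ∀ f : ℝ → ℝ, ContinuousOn f (spectrum ℝ A) := fun f => hfin.continuousOn f
  have hid : cfc (fun x : ℝ => x) A = A := cfc_id' ℝ A
  have h1 : A * pinv A = cfc (fun x : ℝ => x * x⁻¹) A := by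
    rw [cfc_mul (fun x : ℝ => x) (fun x : ℝ => x⁻¹) A (hc _) (hc _), hid, pinv]
  have h2 : pinv A * A = cfc (fun x : ℝ => x * x⁻¹) A := by
    have : (fun x : ℝ => x * x⁻¹) = fun x : ℝ => x⁻¹ * x := by
      funext x; exact mul_comm _ _
    rw [this, cfc_mul (fun x : ℝ => x⁻¹) (fun x : ℝ => x) A (hc _) (hc _), hid, pinv]
  have h3 : (cfc (fun x : ℝ => x * x⁻¹) A)ᵀ = cfc (fun x : ℝ => x * x⁻¹) A := by
    have h := (cfc_predicate (fun x : ℝ => x * x⁻¹) A).star_eq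
    rwa [Matrix.star_eq_conjTranspose, Matrix.conjTranspose_eq_transpose_of_trivial] at h
  refine ⟨?_, ?_, ?_, ?_⟩
  · rw [h1]
    calc cfc (fun x : ℝ => x * x⁻¹) A * A
        = cfc (fun x : ℝ => x * x⁻¹) A * cfc (fun x : ℝ => x) A := by rw [hid]
      _ = cfc (fun x : ℝ => x * x⁻¹ * x) A := by
          rw [← cfc_mul (fun x : ℝ => x * x⁻¹) (fun x : ℝ => x) A (hc _) (hc _)]
      _ = cfc (fun x : ℝ => x) A := by
          congr 1
          funext x
          exact mul_inv_mul_cancel x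
      _ = A := hid
  · rw [h2, pinv, ← cfc_mul (fun x : ℝ => x * x⁻¹) (fun x : ℝ => x⁻¹) A (hc _) (hc _)]
    congr 1
    funext x
    by_cases hx : x = 0
    · simp [hx]
    · simp [hx]
  · rw [h1, h3]
  · rw [h2, h3]

/-- `A^⊥ = I - A A^†`, the orthogonal projection onto the kernel of the symmetric matrix `A`. -/
def perp {d : ℕ} (A : Matrix (Fin d) (Fin d) ℝ) : Matrix (Fin d) (Fin d) ℝ :=
  1 - A * pinv A

/-- Frobenius norm. -/
def frobeniusNorm {d : ℕ} (A : Matrix (Fin d) (Fin d) ℝ) : ℝ :=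
  Real.sqrt (∑ i, ∑ j, A i j ^ 2)

/-- Euclidean norm of the vector `A v`. -/
def mulVecNorm {d : ℕ} (A : Matrix (Fin d) (Fin d) ℝ) (v : EuclideanSpace ℝ (Fin d)) : ℝ :=
  ‖Matrix.toEuclideanLin A v‖

/-- `R = S₀^{-1/2} (S₀^{1/2} S₁ S₀^{1/2})^{1/2} S₀^{-1/2}`. -/
def transportMatrix {d : ℕ} (S₀ S₁ : Matrix (Fin d) (Fin d) ℝ) : Matrix (Fin d) (Fin d) ℝ :=
  (sqrtm S₀)⁻¹ * sqrtm (sqrtm S₀ * S₁ * sqrtm S₀) * (sqrtm S₀)⁻¹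

/-- `Q = (R - I)^† (log(R²) R² - R² + I) (R - I)^†`. -/
def qMatrix {d : ℕ} (R : Matrix (Fin d) (Fin d) ℝ) : Matrix (Fin d) (Fin d) ℝ :=
  pinv (R - 1) * (logm (R ^ 2) * R ^ 2 - R ^ 2 + 1) * pinv (R - 1)

/-! ### Elliptic distributions -/

/-- Admissible generators `g : [0, ∞) → (0, ∞)`; values at negative arguments play no role. -/
structure IsEllipticGenerator (d : ℕ) (g : ℝ → ℝ) : Prop where
  smooth : ContDiffOn ℝ ∞ g (Set.Ici 0)
  pos : ∀ r, 0 ≤ r → 0 < g r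
  integrable : IntegrableOn g (Set.Ioi 0)
  normalization : Real.pi ^ ((d : ℝ) / 2) / Real.Gamma ((d : ℝ) / 2) *
    ∫ r in Set.Ioi (0 : ℝ), r ^ ((d : ℝ) / 2 - 1) * g r = 1
  finite_expectation : IntegrableOn (fun r : ℝ => r ^ (((d : ℝ) - 1) / 2) * g r) (Set.Ioi 0)
  finite_variance : IntegrableOn (fun r : ℝ => r ^ ((d : ℝ) / 2) * g r) (Set.Ioi 0)

/-- The density `p_{m,S,g}(x) = det(S)^{-1/2} g((x - m)ᵀ S⁻¹ (x - m))`. -/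
def ellipticDensity {d : ℕ} (m : EuclideanSpace ℝ (Fin d)) (S : Matrix (Fin d) (Fin d) ℝ)
    (g : ℝ → ℝ) (x : EuclideanSpace ℝ (Fin d)) : ℝ :=
  S.det ^ (-(1 / 2) : ℝ) * g ((x - m).ofLp ⬝ᵥ (S⁻¹ *ᵥ (x - m).ofLp))

/-- The measure with Lebesgue density `ρ`. -/
def toMeasure {d : ℕ} (ρ : EuclideanSpace ℝ (Fin d) → ℝ) : Measure (EuclideanSpace ℝ (Fin d)) :=
  volume.withDensity fun x => ENNReal.ofReal (ρ x)

/-- `μ ∼ E(m, S, g)`. -/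
structure IsElliptic {d : ℕ} (μ : Measure (EuclideanSpace ℝ (Fin d)))
    (m : EuclideanSpace ℝ (Fin d)) (S : Matrix (Fin d) (Fin d) ℝ) (g : ℝ → ℝ) : Prop where
  generator : IsEllipticGenerator d g
  posDef : S.PosDef
  eq_density : μ = toMeasure (ellipticDensity m S g)

/-- `κ_g = (1/d) ∫ ‖y‖² g(‖y‖²) dy`. -/
def kappa (d : ℕ) (g : ℝ → ℝ) : ℝ :=
  1 / (d : ℝ) * ∫ y : EuclideanSpace ℝ (Fin d), ‖y‖ ^ 2 * g (‖y‖ ^ 2)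

/-! ### Dual geodesics and the divergence of the Otto–Wasserstein geometry -/

/-- Smooth positive probability densities on `ℝ^d`. -/
def densityManifold (d : ℕ) : Set (EuclideanSpace ℝ (Fin d) → ℝ) :=
  {ρ | ContDiff ℝ ∞ ρ ∧ (∀ x, 0 < ρ x) ∧ Integrable ρ volume ∧ ∫ x, ρ x = 1}

/-- Divergence `∑ᵢ ∂ᵢ vᵢ` of a vector field on `ℝ^d`. -/
def divergence {d : ℕ} (v : EuclideanSpace ℝ (Fin d) → EuclideanSpace ℝ (Fin d))
    (x : EuclideanSpace ℝ (Fin d)) : ℝ :=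
  ∑ i, (fderiv ℝ v x (EuclideanSpace.single i 1)).ofLp i

/-- The Otto inertia operator `φ_ρ([f]) = -∇ · (ρ ∇f)`. -/
def ottoInertia {d : ℕ} (ρ f : EuclideanSpace ℝ (Fin d) → ℝ) (x : EuclideanSpace ℝ (Fin d)) : ℝ :=
  -divergence (fun y => ρ y • ∇ f y) x

/-- The squared Otto norm `∫ ‖∇f‖² ρ dx` of the tangent vector `φ_ρ([f])`. -/
def ottoNormSq {d : ℕ} (ρ f : EuclideanSpace ℝ (Fin d) → ℝ) : ℝ≥0∞ :=
  ∫⁻ x, ENNReal.ofReal (‖∇ f x‖ ^ 2) ∂(toMeasure ρ)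

/-- The curve `γ` of densities (only `t ∈ [0, 1]` matters) is the dual geodesic whose tangent
vector at every time `t` is `φ_{γ(t)}([f])`, for one and the same smooth potential `f`. -/
structure IsDualGeodesic {d : ℕ} (γ : ℝ → EuclideanSpace ℝ (Fin d) → ℝ)
    (f : EuclideanSpace ℝ (Fin d) → ℝ) : Prop where
  mem : ∀ t ∈ Set.Icc (0 : ℝ) 1, γ t ∈ densityManifold d
  smooth_potential : ContDiff ℝ ∞ f
  hasDeriv : ∀ t ∈ Set.Icc (0 : ℝ) 1, ∀ x,
    HasDerivWithinAt (fun s => γ s x) (ottoInertia (γ t) f x) (Set.Icc 0 1) t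

/-- The canonical contrast function `∫₀¹ t ‖γ'(t)‖²_{γ(t)} dt`, minimized over the dual geodesics
from `μ` to `ν` that belong to the class `C` of curves. -/
def ottoDivergence {d : ℕ} (C : Set (ℝ → EuclideanSpace ℝ (Fin d) → ℝ))
    (μ ν : Measure (EuclideanSpace ℝ (Fin d))) : ℝ≥0∞ :=
  sInf {a | ∃ γ ∈ C, ∃ f, IsDualGeodesic γ f ∧ toMeasure (γ 0) = μ ∧ toMeasure (γ 1) = ν ∧
    a = ∫⁻ t in Set.Icc (0 : ℝ) 1, ENNReal.ofReal t * ottoNormSq (γ t) f}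

/-- Smooth curves in the submanifold `{p_{m,S,g}}` of elliptic densities with generator `g`. -/
def ellipticCurves (d : ℕ) (g : ℝ → ℝ) : Set (ℝ → EuclideanSpace ℝ (Fin d) → ℝ) :=
  {γ | ∃ (m : ℝ → EuclideanSpace ℝ (Fin d)) (S : ℝ → Matrix (Fin d) (Fin d) ℝ),
    ContDiffOn ℝ ∞ m (Set.Icc 0 1) ∧ (∀ i j, ContDiffOn ℝ ∞ (fun t => S t i j) (Set.Icc 0 1)) ∧
    ∀ t ∈ Set.Icc (0 : ℝ) 1, (S t).PosDef ∧ γ t = ellipticDensity (m t) (S t) g}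

/-- The WKL divergence on the elliptic family with generator `g`. The potentials are arbitrary
smooth functions; they are not required to be quadratic. -/
def wklDivergence {d : ℕ} (g : ℝ → ℝ) (μ ν : Measure (EuclideanSpace ℝ (Fin d))) : ℝ≥0∞ :=
  ottoDivergence (ellipticCurves d g) μ ν

end WKL

end

/-!
Finite energy forces the gradient of the potential to be affine. Near a fixed time the smooth
motion of `(m, S)` is also the motion induced by some quadratic potential, so at every time the
difference `φ` of the two potentials satisfies `∇ · (ρ ∇φ) = 0`. Testing this against
`arctan ∘ φ` times a cutoff, and using that `∇φ` is square integrable for `ρ`, gives `∇φ = 0`.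

With gradient `x ↦ A x + b` the parameters solve `m' = A m + b`, `S' = A S + S A`, so
`S₁ = exp(A) S₀ exp(A)` and `m₁ - m₀ = (∫₀¹ exp(sA) ds) (A m₀ + b)`. Uniqueness of the positive
definite solution gives `exp(A) = R`, and `∫₀¹ exp(sA) ds` is invertible, so the affine gradient
is determined by the endpoints. The infimum is therefore attained by a single energy, which is
`∫₀¹ t exp(2tA) dt` paired with the endpoint data; the functional calculus of `A` turns it into
the closed forms.
-/

noncomputable section

namespace WKL

/-! ### Functions of a symmetric matrix -/

theorem transpose_eq_of_isHermitian {n : Type*} {A : Matrix n n ℝ} (hA : A.IsHermitian) :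
    Aᵀ = A := by
  rw [← Matrix.conjTranspose_eq_transpose_of_trivial, hA.eq]

section FunctionalCalculus

open scoped MatrixOrder Matrix.Norms.Operator

variable {n : Type*} [Fintype n] [DecidableEq n] {A B : Matrix n n ℝ}

theorem continuousOn_spectrum (A : Matrix n n ℝ) (f : ℝ → ℝ) : ContinuousOn f (spectrum ℝ A) :=
  A.finite_real_spectrum.continuousOn f

theorem cfc_mul_cfc (f g : ℝ → ℝ) (A : Matrix n n ℝ) :
    cfc f A * cfc g A = cfc (fun x => f x * g x) A :=
  (cfc_mul f g A (continuousOn_spectrum A f) (continuousOn_spectrum A g)).symm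

theorem cfc_add_cfc (f g : ℝ → ℝ) (A : Matrix n n ℝ) :
    cfc f A + cfc g A = cfc (fun x => f x + g x) A :=
  (cfc_add A f g (continuousOn_spectrum A f) (continuousOn_spectrum A g)).symm

theorem cfc_sub_cfc (f g : ℝ → ℝ) (A : Matrix n n ℝ) :
    cfc f A - cfc g A = cfc (fun x => f x - g x) A :=
  (cfc_sub f g A (continuousOn_spectrum A f) (continuousOn_spectrum A g)).symm

theorem cfc_cfc (f g : ℝ → ℝ) (hA : A.IsHermitian) : cfc g (cfc f A) = cfc (fun x => g (f x)) A :=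
  (cfc_comp' g f A ((A.finite_real_spectrum.image f).continuousOn g)
    (continuousOn_spectrum A f) hA).symm

theorem isHermitian_cfc (f : ℝ → ℝ) (A : Matrix n n ℝ) : (cfc f A).IsHermitian :=
  cfc_predicate f A

theorem self_mul_cfc (hA : A.IsHermitian) (f : ℝ → ℝ) :
    A * cfc f A = cfc (fun x => x * f x) A := by
  conv_lhs => rw [← cfc_id' ℝ A hA.isSelfAdjoint, cfc_cfc _ _ hA, cfc_mul_cfc]

theorem cfc_mul_self (hA : A.IsHermitian) (f : ℝ → ℝ) :
    cfc f A * A = cfc (fun x => f x * x) A := by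
  conv_lhs => rw [← cfc_id' ℝ A hA.isSelfAdjoint, cfc_cfc _ _ hA, cfc_mul_cfc]

theorem transpose_cfc (f : ℝ → ℝ) (A : Matrix n n ℝ) : (cfc f A)ᵀ = cfc f A :=
  transpose_eq_of_isHermitian (isHermitian_cfc f A)

theorem spectrum_pos_of_posDef (hA : A.PosDef) {x : ℝ} (hx : x ∈ spectrum ℝ A) : 0 < x :=
  (Matrix.isStrictlyPositive_iff_posDef.2 hA).spectrum_pos hx

theorem posSemidef_cfc {f : ℝ → ℝ} (hf : ∀ x ∈ spectrum ℝ A, 0 ≤ f x) : (cfc f A).PosSemidef :=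
  Matrix.nonneg_iff_posSemidef.1 (cfc_nonneg hf)

theorem posDef_cfc (hA : A.IsHermitian) {f : ℝ → ℝ} (hf : ∀ x ∈ spectrum ℝ A, 0 < f x) :
    (cfc f A).PosDef :=
  Matrix.isStrictlyPositive_iff_posDef.1
    ((cfc_isStrictlyPositive_iff f A (continuousOn_spectrum A f) hA).2 hf)

/-- The matrices `P i` and scalars `a i` do not depend on `f`, so calculus with a parameter
reduces to scalar calculus. -/
theorem exists_cfc_eq_sum (hA : A.IsHermitian) :
    ∃ (a : n → ℝ) (P : n → Matrix n n ℝ),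
      (∀ i, a i ∈ spectrum ℝ A) ∧ ∀ f : ℝ → ℝ, cfc f A = ∑ i, f (a i) • P i := by
  refine ⟨hA.eigenvalues, fun i => Unitary.conjStarAlgAut ℝ _ hA.eigenvectorUnitary
    (Matrix.diagonal (Pi.single i 1)), hA.eigenvalues_mem_spectrum_real, fun f => ?_⟩
  rw [hA.cfc_eq, Matrix.IsHermitian.cfc]
  simp_rw [← map_smul, ← map_sum]
  congr 1
  ext i j
  obtain rfl | h := eq_or_ne i j
  · simp [Matrix.sum_apply, Pi.single_apply]
  · simp [Matrix.sum_apply, h]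

theorem hasDerivAt_cfc (hA : A.IsHermitian) {F F' : ℝ → ℝ → ℝ} {t : ℝ}
    (h : ∀ a ∈ spectrum ℝ A, HasDerivAt (fun s => F s a) (F' t a) t) :
    HasDerivAt (fun s => cfc (F s) A) (cfc (F' t) A) t := by
  obtain ⟨a, P, ha, hP⟩ := exists_cfc_eq_sum hA
  simp_rw [hP]
  exact HasDerivAt.fun_sum fun k _ => (h _ (ha k)).smul_const _

theorem contDiff_cfc (hA : A.IsHermitian) {k : WithTop ℕ∞} {F : ℝ → ℝ → ℝ}
    (h : ∀ a ∈ spectrum ℝ A, ContDiff ℝ k fun s => F s a) : ContDiff ℝ k fun s => cfc (F s) A := by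
  obtain ⟨a, P, ha, hP⟩ := exists_cfc_eq_sum hA
  simp_rw [hP]
  exact ContDiff.sum fun i _ => (h _ (ha i)).smul contDiff_const

theorem intervalIntegral_linearMap_cfc (hA : A.IsHermitian) (ℓ : Matrix n n ℝ →ₗ[ℝ] ℝ)
    {F : ℝ → ℝ → ℝ} {a b : ℝ}
    (h : ∀ x ∈ spectrum ℝ A, IntervalIntegrable (fun s => F s x) volume a b) :
    ∫ s in a..b, ℓ (cfc (F s) A) = ℓ (cfc (fun x => ∫ s in a..b, F s x) A) := by
  obtain ⟨e, P, he, hP⟩ := exists_cfc_eq_sum hA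
  simp_rw [hP, map_sum, map_smul, smul_eq_mul]
  rw [intervalIntegral.integral_finsetSum fun i _ => (h _ (he i)).mul_const _]
  simp_rw [intervalIntegral.integral_mul_const]

theorem mul_inv_of_posDef (hA : A.PosDef) : A * A⁻¹ = 1 :=
  Matrix.mul_nonsing_inv _ hA.det_pos.ne'.isUnit

theorem inv_mul_of_posDef (hA : A.PosDef) : A⁻¹ * A = 1 :=
  Matrix.nonsing_inv_mul _ hA.det_pos.ne'.isUnit

end FunctionalCalculus

section PositiveDefinite

open scoped MatrixOrder Matrix.Norms.Operator

variable {n : Type*} [Fintype n] {A B : Matrix n n ℝ}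

theorem posDef_mul_mul (hA : A.PosDef) (hB : B.PosDef) : (B * A * B).PosDef := by
  classical
  simpa only [hB.isHermitian.eq] using hA.conjTranspose_mul_mul_same (B := B)
    (Matrix.mulVec_injective_of_isUnit hB.isUnit)

theorem posDef_mul_of_commute (hA : A.PosDef) (hB : B.PosDef) (h : Commute A B) :
    (A * B).PosDef := by
  classical
  exact Matrix.isStrictlyPositive_iff_posDef.1 ((IsStrictlyPositive.commute_iff
    (Matrix.isStrictlyPositive_iff_posDef.2 hA) (Matrix.isStrictlyPositive_iff_posDef.2 hB)).1 h)

theorem exists_transpose_mul_self_eq (hA : A.PosSemidef) : ∃ B : Matrix n n ℝ, Bᵀ * B = A := by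
  classical
  refine ⟨CFC.sqrt A, ?_⟩
  rw [transpose_eq_of_isHermitian (Matrix.nonneg_iff_posSemidef.1 (CFC.sqrt_nonneg A)).isHermitian,
    CFC.sqrt_mul_sqrt_self A (Matrix.nonneg_iff_posSemidef.2 hA)]

/-- The trace is the squared Frobenius norm of `A * Bᵀ`, where `S = Bᵀ * B`. -/
theorem eq_zero_of_trace_mul_mul_transpose_eq_zero {S : Matrix n n ℝ} (hS : S.PosDef)
    (h : (A * S * Aᵀ).trace = 0) : A = 0 := by
  classical
  obtain ⟨B, hB⟩ := exists_transpose_mul_self_eq hS.posSemidef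
  have hAB : A * Bᵀ = 0 := by
    rw [← hB] at h
    rwa [← Matrix.trace_mul_conjTranspose_self_eq_zero_iff,
      Matrix.conjTranspose_eq_transpose_of_trivial, Matrix.transpose_mul,
      Matrix.transpose_transpose, Matrix.mul_assoc A, ← Matrix.mul_assoc Bᵀ, ← Matrix.mul_assoc A]
  calc A = A * Bᵀ * B * S⁻¹ := by
        rw [Matrix.mul_assoc A, hB, Matrix.mul_assoc, mul_inv_of_posDef hS, Matrix.mul_one]
    _ = 0 := by rw [hAB, Matrix.zero_mul, Matrix.zero_mul]

end PositiveDefinite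

section Transport

open scoped MatrixOrder Matrix.Norms.Operator

variable {d : ℕ} {A S₀ S₁ X : Matrix (Fin d) (Fin d) ℝ}

theorem sqrtm_eq_cfcSqrt (hA : A.PosSemidef) : sqrtm A = CFC.sqrt A := by
  rw [CFC.sqrt_eq_real_sqrt A (Matrix.nonneg_iff_posSemidef.2 hA), cfcₙ_eq_cfc, sqrtm]

theorem posDef_sqrtm (hA : A.PosDef) : (sqrtm A).PosDef :=
  posDef_cfc hA.isHermitian fun _ hx => Real.sqrt_pos.2 (spectrum_pos_of_posDef hA hx)

theorem transpose_sqrtm (A : Matrix (Fin d) (Fin d) ℝ) : (sqrtm A)ᵀ = sqrtm A :=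
  transpose_cfc _ _

theorem sqrtm_mul_self (hA : A.PosSemidef) : sqrtm A * sqrtm A = A := by
  rw [sqrtm_eq_cfcSqrt hA, CFC.sqrt_mul_sqrt_self A (Matrix.nonneg_iff_posSemidef.2 hA)]

theorem sqrtm_eq_of_mul_self (hX : X.PosSemidef) (h : X * X = A) : sqrtm A = X := by
  have hA : A.PosSemidef := by
    simpa only [hX.isHermitian.eq, h] using Matrix.posSemidef_conjTranspose_mul_self X
  rw [sqrtm_eq_cfcSqrt hA, CFC.sqrt_unique h (Matrix.nonneg_iff_posSemidef.2 hX)]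

theorem det_sqrtm (hA : A.PosSemidef) : (sqrtm A).det = √A.det := by
  rw [sqrtm_eq_cfcSqrt hA, hA.det_sqrt, RCLike.sqrt_real]

theorem posDef_transportMatrix (h₀ : S₀.PosDef) (h₁ : S₁.PosDef) :
    (transportMatrix S₀ S₁).PosDef :=
  posDef_mul_mul (posDef_sqrtm (posDef_mul_mul h₁ (posDef_sqrtm h₀))) (posDef_sqrtm h₀).inv

theorem transportMatrix_mul_mul (h₀ : S₀.PosDef) (h₁ : S₁.PosDef) :
    transportMatrix S₀ S₁ * S₀ * transportMatrix S₀ S₁ = S₁ := by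
  have hL := posDef_sqrtm h₀
  have hLL := sqrtm_mul_self h₀.posSemidef
  have hMM := sqrtm_mul_self (posDef_mul_mul h₁ hL).posSemidef
  rw [transportMatrix]
  set L := sqrtm S₀
  set M := sqrtm (L * S₁ * L)
  calc L⁻¹ * M * L⁻¹ * S₀ * (L⁻¹ * M * L⁻¹)
      = L⁻¹ * M * (L⁻¹ * L) * (L * L⁻¹) * M * L⁻¹ := by
        rw [← hLL]; simp only [Matrix.mul_assoc]
    _ = L⁻¹ * (M * M) * L⁻¹ := by
        rw [mul_inv_of_posDef hL, inv_mul_of_posDef hL]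
        simp only [Matrix.mul_assoc, Matrix.one_mul]
    _ = (L⁻¹ * L) * S₁ * (L * L⁻¹) := by rw [hMM]; simp only [Matrix.mul_assoc]
    _ = S₁ := by rw [mul_inv_of_posDef hL, inv_mul_of_posDef hL, Matrix.one_mul, Matrix.mul_one]

theorem eq_transportMatrix (h₀ : S₀.PosDef) (hX : X.PosDef) (h : X * S₀ * X = S₁) :
    X = transportMatrix S₀ S₁ := by
  have hL := posDef_sqrtm h₀
  have hLL := sqrtm_mul_self h₀.posSemidef
  rw [transportMatrix]
  set L := sqrtm S₀
  have hM : sqrtm (L * S₁ * L) = L * X * L := by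
    refine sqrtm_eq_of_mul_self (posDef_mul_mul hX hL).posSemidef ?_
    rw [← h, ← hLL]
    simp only [Matrix.mul_assoc]
  calc X = (L⁻¹ * L) * X * (L * L⁻¹) := by
        rw [mul_inv_of_posDef hL, inv_mul_of_posDef hL, Matrix.one_mul, Matrix.mul_one]
    _ = L⁻¹ * sqrtm (L * S₁ * L) * L⁻¹ := by rw [hM]; simp only [Matrix.mul_assoc]

theorem commute_sqrtm (h : Commute S₀ S₁) : Commute (sqrtm S₀) (sqrtm S₁) :=
  ((h.cfc_real Real.sqrt).symm.cfc_real Real.sqrt).symm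

theorem transportMatrix_mul_sqrtm_of_commute (h₀ : S₀.PosDef) (h₁ : S₁.PosDef)
    (h : Commute S₀ S₁) : transportMatrix S₀ S₁ * sqrtm S₀ = sqrtm S₁ := by
  have hL := posDef_sqrtm h₀
  have hcomm : Commute (sqrtm S₁) (sqrtm S₀)⁻¹ := by
    obtain ⟨u, hu⟩ := hL.isUnit
    rw [← hu, ← Matrix.coe_units_inv]
    exact Commute.units_inv_right (hu ▸ (commute_sqrtm h).symm)
  have htransport : sqrtm S₁ * (sqrtm S₀)⁻¹ = transportMatrix S₀ S₁ := by
    refine eq_transportMatrix h₀ (posDef_mul_of_commute (posDef_sqrtm h₁) hL.inv hcomm) ?_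
    calc sqrtm S₁ * (sqrtm S₀)⁻¹ * S₀ * (sqrtm S₁ * (sqrtm S₀)⁻¹)
        = sqrtm S₁ * (sqrtm S₀)⁻¹ * (sqrtm S₀ * sqrtm S₀) * ((sqrtm S₀)⁻¹ * sqrtm S₁) := by
          rw [sqrtm_mul_self h₀.posSemidef, ← hcomm.eq]
      _ = sqrtm S₁ * ((sqrtm S₀)⁻¹ * sqrtm S₀) * (sqrtm S₀ * (sqrtm S₀)⁻¹) * sqrtm S₁ := by
          simp only [Matrix.mul_assoc]
      _ = S₁ := by
          rw [inv_mul_of_posDef hL, mul_inv_of_posDef hL, Matrix.mul_one, Matrix.mul_one,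
            sqrtm_mul_self h₁.posSemidef]
  rw [← htransport, Matrix.mul_assoc, inv_mul_of_posDef hL, Matrix.mul_one]

end Transport

/-! ### Matrices acting on Euclidean space -/

theorem sum_norm_row_sq {n : Type*} [Fintype n] (A : Matrix n n ℝ) :
    ∑ i, ‖(WithLp.toLp 2 (A.row i) : EuclideanSpace ℝ n)‖ ^ 2 = (A * Aᵀ).trace := by
  simp_rw [EuclideanSpace.norm_sq_eq, Matrix.trace, Matrix.diag_apply, Matrix.mul_apply,
    Matrix.row_apply, Matrix.transpose_apply, Real.norm_eq_abs, sq_abs, sq]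

section EuclideanAction

variable {n : Type*} [Fintype n] [DecidableEq n]

theorem toEuclideanLin_mul_apply (A B : Matrix n n ℝ) (x : EuclideanSpace ℝ n) :
    (A * B).toEuclideanLin x = A.toEuclideanLin (B.toEuclideanLin x) := by
  simp only [Matrix.toEuclideanLin, Matrix.toLpLin_mul_same, LinearMap.comp_apply]

theorem toEuclideanLin_one_apply (x : EuclideanSpace ℝ n) :
    (1 : Matrix n n ℝ).toEuclideanLin x = x := by
  simp only [Matrix.toEuclideanLin, Matrix.toLpLin_one, LinearMap.id_apply]

theorem inner_toEuclideanLin_right (A : Matrix n n ℝ) (x y : EuclideanSpace ℝ n) :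
    inner ℝ x (A.toEuclideanLin y) = x.ofLp ⬝ᵥ (A *ᵥ y.ofLp) := by
  rw [EuclideanSpace.inner_eq_star_dotProduct, dotProduct_comm]
  rfl

theorem inner_toEuclideanLin_left (A : Matrix n n ℝ) (x y : EuclideanSpace ℝ n) :
    inner ℝ (A.toEuclideanLin x) y = inner ℝ x (Aᵀ.toEuclideanLin y) := by
  rw [← LinearMap.adjoint_inner_right, ← Matrix.toEuclideanLin_conjTranspose_eq_adjoint,
    Matrix.conjTranspose_eq_transpose_of_trivial]

theorem det_toEuclideanLin (A : Matrix n n ℝ) : LinearMap.det A.toEuclideanLin = A.det := by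
  rw [Matrix.toEuclideanLin, Matrix.toLpLin_eq_toLin, LinearMap.det_toLin]

theorem norm_toEuclideanLin_sq (A : Matrix n n ℝ) (x : EuclideanSpace ℝ n) :
    ‖A.toEuclideanLin x‖ ^ 2 = inner ℝ x ((Aᵀ * A).toEuclideanLin x) := by
  rw [← real_inner_self_eq_norm_sq, inner_toEuclideanLin_left, toEuclideanLin_mul_apply]

theorem norm_toEuclideanLin_sq_eq_sum (A : Matrix n n ℝ) (x : EuclideanSpace ℝ n) :
    ‖A.toEuclideanLin x‖ ^ 2 = ∑ i, inner ℝ (WithLp.toLp 2 (A.row i)) x ^ 2 := by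
  simp_rw [EuclideanSpace.norm_sq_eq, Real.norm_eq_abs, sq_abs,
    EuclideanSpace.inner_eq_star_dotProduct, dotProduct_comm x.ofLp]
  rfl

end EuclideanAction

/-! ### Radial densities and their moments -/

section Radial

open Module

variable {E : Type*} [NormedAddCommGroup E] [InnerProductSpace ℝ E] [FiniteDimensional ℝ E]
  [Nontrivial E] [MeasurableSpace E] [BorelSpace E]

theorem integrable_comp_norm_sq_iff (f : ℝ → ℝ) :
    Integrable (fun y : E => f (‖y‖ ^ 2)) ↔
      IntegrableOn (fun r : ℝ => r ^ ((finrank ℝ E : ℝ) / 2 - 1) * f r) (Set.Ioi 0) := by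
  rw [integrable_fun_norm_addHaar (volume : Measure E) (f := fun s => f (s ^ 2)),
    ← integrableOn_Ioi_comp_rpow_iff' (fun r : ℝ => r ^ ((finrank ℝ E : ℝ) / 2 - 1) * f r)
      (two_ne_zero (α := ℝ))]
  refine integrableOn_congr_fun (fun x (hx : 0 < x) => ?_) measurableSet_Ioi
  rw [smul_eq_mul, smul_eq_mul, ← Real.rpow_mul hx.le, ← mul_assoc, ← Real.rpow_add hx,
    Real.rpow_two, ← Real.rpow_natCast x, Nat.cast_pred finrank_pos]
  congr 2
  ring

theorem finrank_mul_volume_unitBall :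
    finrank ℝ E * volume.real (Metric.ball (0 : E) 1) =
      2 * (Real.pi ^ ((finrank ℝ E : ℝ) / 2) / Real.Gamma ((finrank ℝ E : ℝ) / 2)) := by
  have hfin : 0 < (finrank ℝ E : ℝ) := Nat.cast_pos.2 finrank_pos
  have hd : 0 < (finrank ℝ E : ℝ) / 2 := half_pos hfin
  have := Real.Gamma_pos_of_pos hd
  have hpi : √Real.pi ^ finrank ℝ E = Real.pi ^ ((finrank ℝ E : ℝ) / 2) := by
    rw [Real.sqrt_eq_rpow, ← Real.rpow_natCast, ← Real.rpow_mul Real.pi_pos.le]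
    congr 1
    ring
  rw [Measure.real, InnerProductSpace.volume_ball, ENNReal.ofReal_one, one_pow, one_mul,
    ENNReal.toReal_ofReal (by rw [Real.Gamma_add_one hd.ne']; positivity),
    Real.Gamma_add_one hd.ne', hpi]
  field_simp

theorem integral_comp_norm_sq (f : ℝ → ℝ) :
    ∫ y : E, f (‖y‖ ^ 2) =
      Real.pi ^ ((finrank ℝ E : ℝ) / 2) / Real.Gamma ((finrank ℝ E : ℝ) / 2) *
        ∫ r in Set.Ioi (0 : ℝ), r ^ ((finrank ℝ E : ℝ) / 2 - 1) * f r := by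
  have hsubst : ∀ x ∈ Set.Ioi (0 : ℝ), (2 * x ^ ((2 : ℝ) - 1)) •
      ((x ^ (2 : ℝ)) ^ ((finrank ℝ E : ℝ) / 2 - 1) * f (x ^ (2 : ℝ))) =
      2 * (x ^ (finrank ℝ E - 1) • f (x ^ 2)) := by
    intro x (hx : 0 < x)
    have hpow : x ^ ((finrank ℝ E : ℝ) - 1) =
        x ^ ((2 : ℝ) - 1) * x ^ (2 * ((finrank ℝ E : ℝ) / 2 - 1)) := by
      rw [← Real.rpow_add hx]
      congr 1
      ring
    rw [smul_eq_mul, smul_eq_mul, ← Real.rpow_mul hx.le, Real.rpow_two,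
      ← Real.rpow_natCast x (finrank ℝ E - 1), Nat.cast_pred finrank_pos, hpow]
    ring
  rw [integral_fun_norm_addHaar (volume : Measure E) (fun s => f (s ^ 2)),
    ← integral_comp_rpow_Ioi_of_pos
      (g := fun r : ℝ => r ^ ((finrank ℝ E : ℝ) / 2 - 1) * f r) (zero_lt_two (α := ℝ)),
    setIntegral_congr_fun measurableSet_Ioi hsubst, integral_const_mul, nsmul_eq_mul, smul_eq_mul,
    ← mul_assoc, finrank_mul_volume_unitBall]
  ring

end Radial

section IsometryInvariant

open Module

variable {E : Type*} [NormedAddCommGroup E] [InnerProductSpace ℝ E] [MeasurableSpace E]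
  [BorelSpace E] {μ : Measure E}

/-- Invariance of a measure under all linear isometries of the space, which determines its first
and second moments up to one scalar. -/
def IsIsometryInvariant (μ : Measure E) : Prop :=
  ∀ U : E ≃ₗᵢ[ℝ] E, MeasurePreserving U μ μ

theorem IsIsometryInvariant.integral_comp (hμ : IsIsometryInvariant μ) (U : E ≃ₗᵢ[ℝ] E)
    (F : E → ℝ) : ∫ y, F (U y) ∂μ = ∫ y, F y ∂μ :=
  (hμ U).integral_comp U.toHomeomorph.measurableEmbedding F

theorem IsIsometryInvariant.integral_inner (hμ : IsIsometryInvariant μ) (u : E) :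
    ∫ y, inner ℝ u y ∂μ = 0 := by
  have h := hμ.integral_comp (LinearIsometryEquiv.neg ℝ) fun y => inner ℝ u y
  simp only [LinearIsometryEquiv.coe_neg, inner_neg_right, integral_neg] at h
  linarith

theorem IsIsometryInvariant.integral_inner_sq_congr (hμ : IsIsometryInvariant μ) {u v : E}
    (huv : ‖u‖ = ‖v‖) : ∫ y, inner ℝ u y ^ 2 ∂μ = ∫ y, inner ℝ v y ^ 2 ∂μ := by
  let U := (Submodule.span ℝ {u - v})ᗮ.reflection
  have hU (y : E) : inner ℝ v (U y) = inner ℝ u y := by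
    rw [← Submodule.reflection_sub huv, LinearIsometryEquiv.inner_map_map]
  simpa only [hU] using hμ.integral_comp U fun y => inner ℝ v y ^ 2

theorem IsIsometryInvariant.integral_inner_sq [FiniteDimensional ℝ E]
    (hμ : IsIsometryInvariant μ) (h2 : MemLp id 2 μ) (u : E) :
    ∫ y, inner ℝ u y ^ 2 ∂μ = 1 / finrank ℝ E * (∫ y, ‖y‖ ^ 2 ∂μ) * ‖u‖ ^ 2 := by
  obtain hE | hE := eq_or_ne (finrank ℝ E) 0
  · have := finrank_zero_iff.1 hE
    simp [Subsingleton.elim u 0]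
  let b := stdOrthonormalBasis ℝ E
  have hb (i) : ‖u‖ ^ 2 * ∫ y, inner ℝ (b i) y ^ 2 ∂μ = ∫ y, inner ℝ u y ^ 2 ∂μ := by
    rw [hμ.integral_inner_sq_congr (u := u) (v := ‖u‖ • b i) (by simp [norm_smul])]
    simp_rw [real_inner_smul_left, mul_pow, integral_const_mul]
  have hsum : ∫ y, ‖y‖ ^ 2 ∂μ = ∑ i, ∫ y, inner ℝ (b i) y ^ 2 ∂μ := by
    have hint (i) : Integrable (fun y => inner ℝ (b i) y ^ 2) μ :=
      (h2.const_inner (b i)).integrable_sq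
    rw [← integral_finsetSum _ fun i _ => hint i]
    simp_rw [b.sum_sq_inner_right]
  have hcard : ‖u‖ ^ 2 * ∫ y, ‖y‖ ^ 2 ∂μ = finrank ℝ E * ∫ y, inner ℝ u y ^ 2 ∂μ := by
    simp_rw [hsum, Finset.mul_sum, hb, Finset.sum_const, Finset.card_univ, Fintype.card_fin,
      nsmul_eq_mul]
  field_simp
  linarith

end IsometryInvariant

section AffineMoment

variable {n : Type*} [Fintype n] [DecidableEq n] {μ : Measure (EuclideanSpace ℝ n)}
  [IsProbabilityMeasure μ]

theorem norm_add_toEuclideanLin_sq (c y : EuclideanSpace ℝ n) (B : Matrix n n ℝ) :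
    ‖c + B.toEuclideanLin y‖ ^ 2 = (‖c‖ ^ 2 + 2 * inner ℝ (Bᵀ.toEuclideanLin c) y) +
      ∑ i, inner ℝ (WithLp.toLp 2 (B.row i)) y ^ 2 := by
  rw [norm_add_sq_real, norm_toEuclideanLin_sq_eq_sum, inner_toEuclideanLin_left,
    Matrix.transpose_transpose]

theorem integrable_norm_add_toEuclideanLin_sq (h2 : MemLp id 2 μ) (c : EuclideanSpace ℝ n)
    (B : Matrix n n ℝ) : Integrable (fun y => ‖c + B.toEuclideanLin y‖ ^ 2) μ :=
  ((memLp_const c).add (B.toEuclideanLin.toContinuousLinearMap.comp_memLp' h2)).integrable_norm_pow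
    two_ne_zero

theorem integral_norm_add_toEuclideanLin_sq (hμ : IsIsometryInvariant μ) (h2 : MemLp id 2 μ)
    (c : EuclideanSpace ℝ n) (B : Matrix n n ℝ) :
    ∫ y, ‖c + B.toEuclideanLin y‖ ^ 2 ∂μ =
      ‖c‖ ^ 2 + 1 / Fintype.card n * (∫ y, ‖y‖ ^ 2 ∂μ) * (B * Bᵀ).trace := by
  have hlin (u : EuclideanSpace ℝ n) : Integrable (fun y => inner ℝ u y) μ :=
    (h2.const_inner u).integrable one_le_two
  have hsq (u : EuclideanSpace ℝ n) : Integrable (fun y => inner ℝ u y ^ 2) μ :=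
    (h2.const_inner u).integrable_sq
  have haffine : Integrable (fun y => ‖c‖ ^ 2 + 2 * inner ℝ (Bᵀ.toEuclideanLin c) y) μ :=
    (integrable_const _).add ((hlin _).const_mul 2)
  simp_rw [norm_add_toEuclideanLin_sq]
  rw [integral_add haffine (integrable_finsetSum _ fun i _ => hsq _),
    integral_add (integrable_const _) ((hlin _).const_mul 2), integral_const_mul,
    hμ.integral_inner, integral_finsetSum _ fun i _ => hsq _, ← sum_norm_row_sq, Finset.mul_sum]
  simp_rw [hμ.integral_inner_sq h2, finrank_euclideanSpace]
  simp

end AffineMoment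

section StandardLaw

variable {d : ℕ} {g : ℝ → ℝ}

/-- The spherical law `E(0, I, g)`, of which every elliptic law with generator `g` is an affine
image. -/
def standardLaw (d : ℕ) (g : ℝ → ℝ) : Measure (EuclideanSpace ℝ (Fin d)) :=
  toMeasure fun y => g (‖y‖ ^ 2)

namespace IsEllipticGenerator

-- Mathlib's `Γ(0) = 0` makes the normalization read `0 = 1` when `d = 0`.
theorem dim_pos (hg : IsEllipticGenerator d g) : 0 < d := by
  rcases Nat.eq_zero_or_pos d with rfl | hd
  · simpa [Real.Gamma_zero] using hg.normalization
  · exact hd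

theorem nontrivial (hg : IsEllipticGenerator d g) : Nontrivial (EuclideanSpace ℝ (Fin d)) := by
  have : Nonempty (Fin d) := Fin.pos_iff_nonempty.1 hg.dim_pos
  infer_instance

theorem continuous_radial (hg : IsEllipticGenerator d g) :
    Continuous fun y : EuclideanSpace ℝ (Fin d) => g (‖y‖ ^ 2) :=
  hg.smooth.continuousOn.comp_continuous (by fun_prop) fun y => Set.mem_Ici.2 (sq_nonneg _)

theorem radial_pos (hg : IsEllipticGenerator d g) (y : EuclideanSpace ℝ (Fin d)) :
    0 < g (‖y‖ ^ 2) :=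
  hg.pos _ (sq_nonneg _)

theorem integrable_radial (hg : IsEllipticGenerator d g) :
    Integrable fun y : EuclideanSpace ℝ (Fin d) => g (‖y‖ ^ 2) := by
  have := hg.nontrivial
  rw [integrable_comp_norm_sq_iff g, finrank_euclideanSpace_fin]
  refine Integrable.of_integral_ne_zero fun hzero => ?_
  simpa [hzero] using hg.normalization

theorem integral_radial (hg : IsEllipticGenerator d g) :
    ∫ y : EuclideanSpace ℝ (Fin d), g (‖y‖ ^ 2) = 1 := by
  have := hg.nontrivial
  rw [integral_comp_norm_sq g, finrank_euclideanSpace_fin, hg.normalization]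

theorem integrable_norm_sq_mul_radial (hg : IsEllipticGenerator d g) :
    Integrable fun y : EuclideanSpace ℝ (Fin d) => ‖y‖ ^ 2 * g (‖y‖ ^ 2) := by
  have := hg.nontrivial
  rw [integrable_comp_norm_sq_iff fun r => r * g r, finrank_euclideanSpace_fin]
  refine (integrableOn_congr_fun (fun x (hx : 0 < x) => ?_) measurableSet_Ioi).1 hg.finite_variance
  rw [← mul_assoc, Real.rpow_sub_one hx.ne', div_mul_cancel₀ _ hx.ne']

theorem isProbabilityMeasure_standardLaw (hg : IsEllipticGenerator d g) :
    IsProbabilityMeasure (standardLaw d g) := by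
  constructor
  rw [standardLaw, toMeasure, withDensity_apply _ MeasurableSet.univ, Measure.restrict_univ,
    ← ofReal_integral_eq_lintegral_ofReal hg.integrable_radial
      (Filter.Eventually.of_forall fun y => (hg.radial_pos y).le),
    hg.integral_radial, ENNReal.ofReal_one]

theorem isIsometryInvariant_standardLaw (hg : IsEllipticGenerator d g) :
    IsIsometryInvariant (standardLaw d g) := by
  refine fun U => ⟨U.continuous.measurable, Measure.ext fun s hs => ?_⟩
  rw [Measure.map_apply U.continuous.measurable hs, standardLaw, toMeasure,
    withDensity_apply _ hs, withDensity_apply _ (U.continuous.measurable hs),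
    ← U.measurePreserving.setLIntegral_comp_preimage hs
      hg.continuous_radial.measurable.ennreal_ofReal]
  simp_rw [LinearIsometryEquiv.norm_map]

theorem memLp_id_standardLaw (hg : IsEllipticGenerator d g) : MemLp id 2 (standardLaw d g) := by
  rw [memLp_two_iff_integrable_sq_norm aestronglyMeasurable_id, standardLaw, toMeasure,
    integrable_withDensity_iff hg.continuous_radial.measurable.ennreal_ofReal (by simp)]
  simp_rw [ENNReal.toReal_ofReal (hg.radial_pos _).le]
  exact hg.integrable_norm_sq_mul_radial

theorem kappa_eq (hg : IsEllipticGenerator d g) :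
    kappa d g = 1 / d * ∫ y, ‖y‖ ^ 2 ∂standardLaw d g := by
  rw [kappa, standardLaw, toMeasure, integral_withDensity_eq_integral_toReal_smul
    hg.continuous_radial.measurable.ennreal_ofReal (by simp)]
  simp_rw [ENNReal.toReal_ofReal (hg.radial_pos _).le, smul_eq_mul, mul_comm (g _)]

theorem kappa_pos (hg : IsEllipticGenerator d g) : 0 < kappa d g := by
  have := hg.nontrivial
  have hd : (0 : ℝ) < d := Nat.cast_pos.2 hg.dim_pos
  obtain ⟨y, hy⟩ := exists_ne (0 : EuclideanSpace ℝ (Fin d))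
  refine mul_pos (by positivity) (integral_pos_of_integrable_nonneg_nonzero (x := y)
    ((by fun_prop : Continuous fun y : EuclideanSpace ℝ (Fin d) => ‖y‖ ^ 2).mul
      hg.continuous_radial) hg.integrable_norm_sq_mul_radial
    (fun z => mul_nonneg (sq_nonneg _) (hg.radial_pos z).le) ?_)
  exact (mul_pos (by positivity) (hg.radial_pos y)).ne'

theorem integrable_norm_add_toEuclideanLin_sq_standardLaw (hg : IsEllipticGenerator d g)
    (c : EuclideanSpace ℝ (Fin d)) (B : Matrix (Fin d) (Fin d) ℝ) :
    Integrable (fun y => ‖c + B.toEuclideanLin y‖ ^ 2) (standardLaw d g) :=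
  have := hg.isProbabilityMeasure_standardLaw
  integrable_norm_add_toEuclideanLin_sq hg.memLp_id_standardLaw c B

theorem integral_norm_add_toEuclideanLin_sq_standardLaw (hg : IsEllipticGenerator d g)
    (c : EuclideanSpace ℝ (Fin d)) (B : Matrix (Fin d) (Fin d) ℝ) :
    ∫ y, ‖c + B.toEuclideanLin y‖ ^ 2 ∂standardLaw d g =
      ‖c‖ ^ 2 + kappa d g * (B * Bᵀ).trace := by
  have := hg.isProbabilityMeasure_standardLaw
  rw [integral_norm_add_toEuclideanLin_sq hg.isIsometryInvariant_standardLaw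
    hg.memLp_id_standardLaw, hg.kappa_eq, Fintype.card_fin]

end IsEllipticGenerator

end StandardLaw

/-! ### Elliptic laws as affine images of the standard law -/

section AffineImage

theorem withDensity_map {α β : Type*} [MeasurableSpace α] [MeasurableSpace β] {μ : Measure α}
    {T : α → β} {F : β → ℝ≥0∞} (hF : Measurable F) (hT : Measurable T) :
    (μ.map T).withDensity F = (μ.withDensity fun x => F (T x)).map T := by
  ext s hs
  rw [withDensity_apply _ hs, Measure.map_apply hT hs, withDensity_apply _ (hT hs),
    setLIntegral_map hs hF hT]

variable {n : Type*} [Fintype n] [DecidableEq n]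

theorem measurable_add_toEuclideanLin (c : EuclideanSpace ℝ n) (B : Matrix n n ℝ) :
    Measurable fun y : EuclideanSpace ℝ n => c + B.toEuclideanLin y :=
  (continuous_const.add (LinearMap.continuous_of_finiteDimensional _)).measurable

theorem map_add_toEuclideanLin_volume (c : EuclideanSpace ℝ n) {B : Matrix n n ℝ}
    (hB : B.det ≠ 0) :
    (volume : Measure (EuclideanSpace ℝ n)).map (fun y => c + B.toEuclideanLin y) =
      ENNReal.ofReal |B.det⁻¹| • volume := by
  have hlin := Measure.map_linearMap_addHaar_eq_smul_addHaar
    (volume : Measure (EuclideanSpace ℝ n)) (f := B.toEuclideanLin)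
    (by rwa [det_toEuclideanLin])
  have hcomp : (fun y : EuclideanSpace ℝ n => c + B.toEuclideanLin y) =
      (fun y => c + y) ∘ B.toEuclideanLin := rfl
  rw [hcomp, ← Measure.map_map (measurable_const_add c)
      (LinearMap.continuous_of_finiteDimensional _).measurable, hlin, Measure.map_smul,
    map_add_left_eq_self, det_toEuclideanLin]

end AffineImage

section EllipticLaw

variable {d : ℕ} {g : ℝ → ℝ} {m m' : EuclideanSpace ℝ (Fin d)}
  {S S' : Matrix (Fin d) (Fin d) ℝ}

theorem dotProduct_inv_mulVec_nonneg (hS : S.PosDef) (z : EuclideanSpace ℝ (Fin d)) :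
    0 ≤ z.ofLp ⬝ᵥ (S⁻¹ *ᵥ z.ofLp) := by
  simpa only [star_trivial] using hS.inv.posSemidef.dotProduct_mulVec_nonneg z.ofLp

theorem dotProduct_inv_mulVec_sqrtm (hS : S.PosDef) (y : EuclideanSpace ℝ (Fin d)) :
    ((sqrtm S).toEuclideanLin y).ofLp ⬝ᵥ (S⁻¹ *ᵥ ((sqrtm S).toEuclideanLin y).ofLp) =
      ‖y‖ ^ 2 := by
  have hL := posDef_sqrtm hS
  have hinv : sqrtm S * (S⁻¹ * sqrtm S) = 1 := by
    conv_lhs => enter [2, 1]; rw [← sqrtm_mul_self hS.posSemidef, Matrix.mul_inv_rev]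
    rw [Matrix.mul_assoc, inv_mul_of_posDef hL, Matrix.mul_one, mul_inv_of_posDef hL]
  rw [← inner_toEuclideanLin_right, inner_toEuclideanLin_left, transpose_sqrtm,
    ← toEuclideanLin_mul_apply, ← toEuclideanLin_mul_apply, Matrix.mul_assoc, hinv,
    toEuclideanLin_one_apply, real_inner_self_eq_norm_sq]

theorem contDiff_ellipticDensity (hg : IsEllipticGenerator d g) (hS : S.PosDef) :
    ContDiff ℝ ∞ (ellipticDensity m S g) := by
  have hquad : ContDiff ℝ ∞ fun x : EuclideanSpace ℝ (Fin d) =>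
      (x - m).ofLp ⬝ᵥ (S⁻¹ *ᵥ (x - m).ofLp) := by
    simp only [dotProduct, Matrix.mulVec]
    fun_prop
  refine contDiff_const.mul (contDiffOn_univ.1 ?_)
  exact hg.smooth.comp hquad.contDiffOn fun x _ => dotProduct_inv_mulVec_nonneg hS _

theorem ellipticDensity_pos (hg : IsEllipticGenerator d g) (hS : S.PosDef)
    (x : EuclideanSpace ℝ (Fin d)) : 0 < ellipticDensity m S g x :=
  mul_pos (Real.rpow_pos_of_pos hS.det_pos _) (hg.pos _ (dotProduct_inv_mulVec_nonneg hS _))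

theorem ellipticDensity_add_sqrtm (hS : S.PosDef) (y : EuclideanSpace ℝ (Fin d)) :
    ellipticDensity m S g (m + (sqrtm S).toEuclideanLin y) =
      (sqrtm S).det⁻¹ * g (‖y‖ ^ 2) := by
  rw [ellipticDensity, add_sub_cancel_left, dotProduct_inv_mulVec_sqrtm hS,
    Real.rpow_neg hS.det_pos.le, det_sqrtm hS.posSemidef, Real.sqrt_eq_rpow]

theorem toMeasure_ellipticDensity (hg : IsEllipticGenerator d g) (hS : S.PosDef) :
    toMeasure (ellipticDensity m S g) =
      (standardLaw d g).map fun y => m + (sqrtm S).toEuclideanLin y := by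
  have hdet : 0 < (sqrtm S).det := (posDef_sqrtm hS).det_pos
  have hinv : ENNReal.ofReal (sqrtm S).det * ENNReal.ofReal (sqrtm S).det⁻¹ = 1 := by
    rw [← ENNReal.ofReal_mul hdet.le, mul_inv_cancel₀ hdet.ne', ENNReal.ofReal_one]
  have hvol : (volume : Measure (EuclideanSpace ℝ (Fin d))) = ENNReal.ofReal (sqrtm S).det •
      volume.map (fun y => m + (sqrtm S).toEuclideanLin y) := by
    rw [map_add_toEuclideanLin_volume m hdet.ne', abs_of_pos (inv_pos.2 hdet), smul_smul, hinv,
      one_smul]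
  have hdens : (fun y => ENNReal.ofReal (ellipticDensity m S g (m + (sqrtm S).toEuclideanLin y))) =
      ENNReal.ofReal (sqrtm S).det⁻¹ • fun y => ENNReal.ofReal (g (‖y‖ ^ 2)) := by
    funext y
    rw [ellipticDensity_add_sqrtm hS, ENNReal.ofReal_mul (inv_pos.2 hdet).le, Pi.smul_apply,
      smul_eq_mul]
  rw [toMeasure, hvol, withDensity_smul_measure,
    withDensity_map (contDiff_ellipticDensity hg hS).continuous.measurable.ennreal_ofReal
      (measurable_add_toEuclideanLin m _), hdens,
    withDensity_smul _ hg.continuous_radial.measurable.ennreal_ofReal, Measure.map_smul, smul_smul,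
    hinv, one_smul, standardLaw, toMeasure]

theorem lintegral_ellipticDensity (hg : IsEllipticGenerator d g) (hS : S.PosDef) :
    ∫⁻ x, ENNReal.ofReal (ellipticDensity m S g x) = 1 := by
  have := hg.isProbabilityMeasure_standardLaw
  have hmeasure := congrArg (· Set.univ) (toMeasure_ellipticDensity (m := m) hg hS)
  simpa only [toMeasure, withDensity_apply _ MeasurableSet.univ, Measure.restrict_univ,
    Measure.map_apply (measurable_add_toEuclideanLin m _) MeasurableSet.univ, Set.preimage_univ,
    measure_univ] using hmeasure

theorem ellipticDensity_mem_densityManifold (hg : IsEllipticGenerator d g) (hS : S.PosDef) :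
    ellipticDensity m S g ∈ densityManifold d := by
  have hnonneg : ∀ᵐ x, 0 ≤ ellipticDensity m S g x :=
    Filter.Eventually.of_forall fun x => (ellipticDensity_pos hg hS x).le
  have hmeas := (contDiff_ellipticDensity (m := m) hg hS).continuous.aestronglyMeasurable
    (μ := volume)
  refine ⟨contDiff_ellipticDensity hg hS, ellipticDensity_pos hg hS, ⟨hmeas, ?_⟩, ?_⟩
  · rw [hasFiniteIntegral_iff_ofReal hnonneg, lintegral_ellipticDensity hg hS]
    exact ENNReal.one_lt_top
  · rw [integral_eq_lintegral_of_nonneg_ae hnonneg hmeas, lintegral_ellipticDensity hg hS,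
      ENNReal.toReal_one]

theorem integrable_ellipticDensity (hg : IsEllipticGenerator d g) (hS : S.PosDef) :
    Integrable (ellipticDensity m S g) :=
  (ellipticDensity_mem_densityManifold hg hS).2.2.1

theorem lintegral_norm_affine_sq (hg : IsEllipticGenerator d g) (hS : S.PosDef)
    (A : Matrix (Fin d) (Fin d) ℝ) (b : EuclideanSpace ℝ (Fin d)) :
    ∫⁻ x, ENNReal.ofReal (‖A.toEuclideanLin x + b‖ ^ 2) ∂toMeasure (ellipticDensity m S g) =
      ENNReal.ofReal (‖A.toEuclideanLin m + b‖ ^ 2 + kappa d g * (A * S * Aᵀ).trace) := by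
  have hA : Continuous fun x : EuclideanSpace ℝ (Fin d) => A.toEuclideanLin x :=
    LinearMap.continuous_of_finiteDimensional _
  have hcomp (y : EuclideanSpace ℝ (Fin d)) :
      A.toEuclideanLin (m + (sqrtm S).toEuclideanLin y) + b =
        (A.toEuclideanLin m + b) + (A * sqrtm S).toEuclideanLin y := by
    rw [map_add, toEuclideanLin_mul_apply]
    abel
  have hscatter : A * sqrtm S * (A * sqrtm S)ᵀ = A * S * Aᵀ := by
    rw [Matrix.transpose_mul, transpose_sqrtm, Matrix.mul_assoc, ← Matrix.mul_assoc (sqrtm S),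
      sqrtm_mul_self hS.posSemidef, Matrix.mul_assoc]
  rw [toMeasure_ellipticDensity hg hS,
    lintegral_map (by fun_prop) (measurable_add_toEuclideanLin m _)]
  simp_rw [hcomp]
  rw [← ofReal_integral_eq_lintegral_ofReal
      (hg.integrable_norm_add_toEuclideanLin_sq_standardLaw _ _)
      (Filter.Eventually.of_forall fun y => sq_nonneg _),
    hg.integral_norm_add_toEuclideanLin_sq_standardLaw, hscatter]

end EllipticLaw

section Injectivity

variable {n : Type*} [Fintype n]

theorem trace_mul_mul_transpose_nonneg {S : Matrix n n ℝ} (hS : S.PosDef) (A : Matrix n n ℝ) :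
    0 ≤ (A * S * Aᵀ).trace := by
  simpa only [Matrix.conjTranspose_eq_transpose_of_trivial] using
    (hS.posSemidef.mul_mul_conjTranspose_same A).trace_nonneg

theorem eq_zero_of_forall_trace_mul_mul_transpose_eq_zero {D : Matrix n n ℝ}
    (hD : D.IsHermitian) (h : ∀ A : Matrix n n ℝ, (A * D * Aᵀ).trace = 0) : D = 0 := by
  classical
  have hDt := transpose_eq_of_isHermitian hD
  have hone := h 1
  have hself := h D
  have hsum := h (1 + D)
  simp only [Matrix.transpose_add, Matrix.transpose_one, hDt, Matrix.add_mul, Matrix.mul_add,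
    Matrix.one_mul, Matrix.mul_one, Matrix.trace_add] at hone hself hsum
  refine Matrix.trace_mul_conjTranspose_self_eq_zero_iff.1 ?_
  rw [hD.eq]
  linarith

variable {d : ℕ} {g : ℝ → ℝ} {m m' : EuclideanSpace ℝ (Fin d)}
  {S S' : Matrix (Fin d) (Fin d) ℝ}

theorem elliptic_injective (hg : IsEllipticGenerator d g) (hS : S.PosDef) (hS' : S'.PosDef)
    (h : toMeasure (ellipticDensity m S g) = toMeasure (ellipticDensity m' S' g)) :
    m = m' ∧ S = S' := by
  have hκ := hg.kappa_pos
  have hmoment (A : Matrix (Fin d) (Fin d) ℝ) (b : EuclideanSpace ℝ (Fin d)) :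
      ‖A.toEuclideanLin m + b‖ ^ 2 + kappa d g * (A * S * Aᵀ).trace =
        ‖A.toEuclideanLin m' + b‖ ^ 2 + kappa d g * (A * S' * Aᵀ).trace := by
    have hint := lintegral_norm_affine_sq (m := m) hg hS A b
    have hnonneg := mul_nonneg hκ.le (trace_mul_mul_transpose_nonneg hS A)
    have hnonneg' := mul_nonneg hκ.le (trace_mul_mul_transpose_nonneg hS' A)
    rw [h, lintegral_norm_affine_sq hg hS' A b] at hint
    exact ((ENNReal.ofReal_eq_ofReal_iff (by positivity) (by positivity)).1 hint).symm
  have hmean : m = m' := by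
    have hcenter := hmoment 1 (-m)
    have hcenter' := hmoment 1 (-m')
    simp only [toEuclideanLin_one_apply, ← sub_eq_add_neg, sub_self, norm_zero,
      norm_sub_rev m' m] at hcenter hcenter'
    have hsq : ‖m - m'‖ ^ 2 = 0 := by linarith
    exact sub_eq_zero.1 (norm_eq_zero.1 (pow_eq_zero_iff two_ne_zero |>.1 hsq))
  subst hmean
  refine ⟨rfl, sub_eq_zero.1 (eq_zero_of_forall_trace_mul_mul_transpose_eq_zero
    (hS.isHermitian.sub hS'.isHermitian) fun A => ?_)⟩
  rw [Matrix.mul_sub, Matrix.sub_mul, Matrix.trace_sub, sub_eq_zero]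
  exact mul_left_cancel₀ hκ.ne' (add_left_cancel (hmoment A 0))

end Injectivity

/-! ### Curves of matrices -/

section MatrixCurves

open scoped Matrix.Norms.Operator

variable {n : Type*} {S : ℝ → Matrix n n ℝ} {S' : Matrix n n ℝ} {s : Set ℝ} {t : ℝ}

theorem hasDerivWithinAt_matrix_iff [Finite n] :
    HasDerivWithinAt S S' s t ↔ ∀ i j, HasDerivWithinAt (fun τ => S τ i j) (S' i j) s t := by
  have := Fintype.ofFinite n
  rw [← forall_congr' fun i => hasDerivWithinAt_pi (φ := fun τ => S τ i) (φ' := S' i)]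
  exact hasDerivWithinAt_pi

variable [Fintype n] [DecidableEq n]

theorem hasDerivWithinAt_toEuclideanLin_apply {m : ℝ → EuclideanSpace ℝ n}
    {m' : EuclideanSpace ℝ n} (hS : HasDerivWithinAt S S' s t) (hm : HasDerivWithinAt m m' s t) :
    HasDerivWithinAt (fun τ => (S τ).toEuclideanLin (m τ))
      (S'.toEuclideanLin (m t) + (S t).toEuclideanLin m') s t := by
  let Φ : Matrix n n ℝ →ₗ[ℝ] EuclideanSpace ℝ n →L[ℝ] EuclideanSpace ℝ n :=
    LinearMap.toContinuousLinearMap.toLinearMap ∘ₗ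
      (Matrix.toEuclideanLin (𝕜 := ℝ) (m := n) (n := n)).toLinearMap
  exact (Φ.toContinuousLinearMap.hasFDerivAt.comp_hasDerivWithinAt t hS).clm_apply hm

theorem hasDerivWithinAt_matrix_inv (hS : HasDerivWithinAt S S' s t) (hSt : IsUnit (S t)) :
    HasDerivWithinAt (fun τ => (S τ)⁻¹) (-((S t)⁻¹ * S' * (S t)⁻¹)) s t := by
  obtain ⟨U, hU⟩ := hSt
  have hinv := hasFDerivAt_ringInverse (𝕜 := ℝ) U
  rw [hU] at hinv
  simp_rw [Matrix.nonsing_inv_eq_ringInverse]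
  refine (hinv.comp_hasDerivWithinAt t hS).congr_deriv ?_
  simp [← hU]

theorem sum_det_updateRow (A B : Matrix n n ℝ) :
    ∑ i, (A.updateRow i (B i)).det = (B * A.adjugate).trace := by
  simp_rw [Matrix.trace, Matrix.diag_apply, Matrix.mul_apply, ← Matrix.cramer_transpose_apply,
    Matrix.cramer_eq_adjugate_mulVec, Matrix.mulVec, dotProduct, ← Matrix.adjugate_transpose,
    Matrix.transpose_apply, mul_comm]

theorem hasDerivWithinAt_det (hS : HasDerivWithinAt S S' s t) :
    HasDerivWithinAt (fun τ => (S τ).det) (S' * (S t).adjugate).trace s t := by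
  let D : ContinuousMultilinearMap ℝ (fun _ : n => n → ℝ) ℝ :=
    ⟨Matrix.detRowAlternating.toMultilinearMap, continuous_id.matrix_det⟩
  have hrow (i : n) : HasDerivWithinAt (fun τ => S τ i) (S' i) s t := hasDerivWithinAt_pi.1 hS i
  refine ((HasFDerivWithinAt.multilinear_comp D
    fun i => (hrow i).hasFDerivWithinAt).hasDerivWithinAt).congr_deriv ?_
  rw [← sum_det_updateRow]
  simp only [sum_apply, ContinuousLinearMap.comp_apply, ContinuousLinearMap.toSpanSingleton_apply,
    one_smul]
  rfl

variable {A : Matrix n n ℝ}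

theorem inner_toEuclideanLin_comm (hA : A.IsHermitian) (x y : EuclideanSpace ℝ n) :
    inner ℝ (A.toEuclideanLin x) y = inner ℝ x (A.toEuclideanLin y) := by
  rw [inner_toEuclideanLin_left, transpose_eq_of_isHermitian hA]

theorem hasDerivWithinAt_det_rpow (p : ℝ) (hSt : (S t).PosDef)
    (hS : HasDerivWithinAt S (A * S t + S t * A) s t) :
    HasDerivWithinAt (fun τ => (S τ).det ^ p) (2 * p * A.trace * (S t).det ^ p) s t := by
  have hdet := hSt.det_pos.ne'
  refine ((hasDerivWithinAt_det hS).rpow_const (Or.inl hdet)).congr_deriv ?_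
  have htrace : ((A * S t + S t * A) * (S t).adjugate).trace = 2 * A.trace * (S t).det := by
    rw [Matrix.add_mul, Matrix.trace_add, Matrix.mul_assoc, Matrix.mul_adjugate,
      Matrix.trace_mul_cycle, Matrix.adjugate_mul]
    simp only [Matrix.mul_smul, Matrix.smul_mul, Matrix.mul_one, Matrix.one_mul,
      Matrix.trace_smul, smul_eq_mul]
    ring
  rw [htrace, Real.rpow_sub_one hdet]
  field_simp

theorem hasDerivWithinAt_inner_inv {z : ℝ → EuclideanSpace ℝ n} {z' : EuclideanSpace ℝ n}
    (hSt : (S t).PosDef) (hA : A.IsHermitian) (hz : HasDerivWithinAt z z' s t)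
    (hS : HasDerivWithinAt S (A * S t + S t * A) s t) :
    HasDerivWithinAt (fun τ => inner ℝ (z τ) ((S τ)⁻¹.toEuclideanLin (z τ)))
      (2 * inner ℝ (z' - A.toEuclideanLin (z t)) ((S t)⁻¹.toEuclideanLin (z t))) s t := by
  have hinv := hasDerivWithinAt_matrix_inv hS hSt.isUnit
  have hconj : (S t)⁻¹ * (A * S t + S t * A) * (S t)⁻¹ = (S t)⁻¹ * A + A * (S t)⁻¹ := by
    rw [Matrix.mul_add, Matrix.add_mul, ← Matrix.mul_assoc, ← Matrix.mul_assoc,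
      inv_mul_of_posDef hSt, Matrix.one_mul, Matrix.mul_assoc _ (S t), mul_inv_of_posDef hSt,
      Matrix.mul_one]
  rw [hconj] at hinv
  refine (hz.inner ℝ (hasDerivWithinAt_toEuclideanLin_apply hinv hz)).congr_deriv ?_
  have hsymm (y : EuclideanSpace ℝ n) : inner ℝ (z t) ((S t)⁻¹.toEuclideanLin y) =
      inner ℝ y ((S t)⁻¹.toEuclideanLin (z t)) := by
    rw [real_inner_comm, inner_toEuclideanLin_comm hSt.inv.isHermitian]
  simp only [map_neg, map_add, LinearMap.neg_apply, LinearMap.add_apply, toEuclideanLin_mul_apply,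
    inner_add_right, inner_neg_right, hsymm, ← inner_toEuclideanLin_comm hA, inner_sub_left]
  ring

end MatrixCurves

/-! ### Quadratic potentials and the motion of elliptic densities -/

section Quadratic

variable {d : ℕ} {A : Matrix (Fin d) (Fin d) ℝ} {b : EuclideanSpace ℝ (Fin d)}

/-- The potential `x ↦ (x, A x) / 2 + (b, x)`, whose gradient is `x ↦ A x + b` for symmetric `A`. -/
def quadPotential (A : Matrix (Fin d) (Fin d) ℝ) (b x : EuclideanSpace ℝ (Fin d)) : ℝ :=
  1 / 2 * inner ℝ x (A.toEuclideanLin x) + inner ℝ b x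

theorem contDiff_toEuclideanLin {k : WithTop ℕ∞} (A : Matrix (Fin d) (Fin d) ℝ) :
    ContDiff ℝ k fun x : EuclideanSpace ℝ (Fin d) => A.toEuclideanLin x :=
  A.toEuclideanLin.toContinuousLinearMap.contDiff

theorem contDiff_quadPotential {k : WithTop ℕ∞} (A : Matrix (Fin d) (Fin d) ℝ)
    (b : EuclideanSpace ℝ (Fin d)) : ContDiff ℝ k (quadPotential A b) :=
  (contDiff_const.mul (contDiff_id.inner ℝ (contDiff_toEuclideanLin A))).add
    (contDiff_const.inner ℝ contDiff_id)

theorem hasFDerivAt_toEuclideanLin_add (A : Matrix (Fin d) (Fin d) ℝ)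
    (b x : EuclideanSpace ℝ (Fin d)) :
    HasFDerivAt (fun y : EuclideanSpace ℝ (Fin d) => A.toEuclideanLin y + b)
      A.toEuclideanLin.toContinuousLinearMap x :=
  A.toEuclideanLin.toContinuousLinearMap.hasFDerivAt.add_const b

theorem gradient_quadPotential (hA : A.IsHermitian) (b x : EuclideanSpace ℝ (Fin d)) :
    ∇ (quadPotential A b) x = A.toEuclideanLin x + b := by
  have hquad := ((hasFDerivAt_id x).inner ℝ A.toEuclideanLin.toContinuousLinearMap.hasFDerivAt)
  have hderiv := (hquad.const_mul (1 / 2)).add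
    ((hasFDerivAt_const b x).inner ℝ (hasFDerivAt_id x))
  refine HasGradientAt.gradient (hasGradientAt_iff_hasFDerivAt.2 (hderiv.congr_fderiv ?_))
  ext u
  have hsymm : inner ℝ u (A.toEuclideanLin x) = inner ℝ x (A.toEuclideanLin u) := by
    rw [← inner_toEuclideanLin_comm hA, real_inner_comm]
  simp [hsymm, inner_toEuclideanLin_comm hA]
  ring

theorem apply_eq_sum_single (L : EuclideanSpace ℝ (Fin d) →L[ℝ] ℝ) (v : EuclideanSpace ℝ (Fin d)) :
    L v = ∑ i, L (EuclideanSpace.single i 1) * v.ofLp i := by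
  conv_lhs => rw [← (EuclideanSpace.basisFun (Fin d) ℝ).sum_repr v]
  simp [mul_comm]

theorem divergence_smul {ρ : EuclideanSpace ℝ (Fin d) → ℝ}
    {v : EuclideanSpace ℝ (Fin d) → EuclideanSpace ℝ (Fin d)} {x : EuclideanSpace ℝ (Fin d)}
    (hρ : DifferentiableAt ℝ ρ x) (hv : DifferentiableAt ℝ v x) :
    divergence (fun y => ρ y • v y) x = fderiv ℝ ρ x (v x) + ρ x * divergence v x := by
  rw [apply_eq_sum_single (fderiv ℝ ρ x)]
  simp only [divergence, fderiv_fun_smul hρ hv, Finset.mul_sum, ← Finset.sum_add_distrib]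
  refine Finset.sum_congr rfl fun i _ => ?_
  simp
  ring

theorem divergence_toEuclideanLin_add (A : Matrix (Fin d) (Fin d) ℝ)
    (b x : EuclideanSpace ℝ (Fin d)) :
    divergence (fun y => A.toEuclideanLin y + b) x = A.trace := by
  simp [divergence, (hasFDerivAt_toEuclideanLin_add A b x).fderiv, Matrix.trace]

theorem ottoInertia_quadPotential (hA : A.IsHermitian) {ρ : EuclideanSpace ℝ (Fin d) → ℝ}
    {x : EuclideanSpace ℝ (Fin d)} (hρ : DifferentiableAt ℝ ρ x) :
    ottoInertia ρ (quadPotential A b) x =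
      -(fderiv ℝ ρ x (A.toEuclideanLin x + b) + ρ x * A.trace) := by
  rw [ottoInertia]
  simp_rw [gradient_quadPotential hA]
  rw [divergence_smul hρ (hasFDerivAt_toEuclideanLin_add A b x).differentiableAt,
    divergence_toEuclideanLin_add]

end Quadratic

section Velocity

open scoped Matrix.Norms.Operator

variable {d : ℕ} {g : ℝ → ℝ} {m x : ℝ → EuclideanSpace ℝ (Fin d)}
  {m' x' b : EuclideanSpace ℝ (Fin d)} {S : ℝ → Matrix (Fin d) (Fin d) ℝ}
  {A : Matrix (Fin d) (Fin d) ℝ} {s : Set ℝ} {t : ℝ}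

theorem ellipticDensity_eq_inner (m x : EuclideanSpace ℝ (Fin d)) (S : Matrix (Fin d) (Fin d) ℝ)
    (g : ℝ → ℝ) : ellipticDensity m S g x =
      S.det ^ (-(1 / 2) : ℝ) * g (inner ℝ (x - m) (S⁻¹.toEuclideanLin (x - m))) := by
  rw [ellipticDensity, inner_toEuclideanLin_right]

theorem inner_inv_nonneg {S : Matrix (Fin d) (Fin d) ℝ} (hS : S.PosDef)
    (z : EuclideanSpace ℝ (Fin d)) : 0 ≤ inner ℝ z (S⁻¹.toEuclideanLin z) := by
  rw [inner_toEuclideanLin_right]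
  exact dotProduct_inv_mulVec_nonneg hS z

theorem hasDerivWithinAt_ellipticDensity_apply (hg : IsEllipticGenerator d g)
    (hpos : ∀ τ ∈ s, (S τ).PosDef) (ht : t ∈ s) (hA : A.IsHermitian)
    (hm : HasDerivWithinAt m m' s t) (hx : HasDerivWithinAt x x' s t)
    (hS : HasDerivWithinAt S (A * S t + S t * A) s t) :
    HasDerivWithinAt (fun τ => ellipticDensity (m τ) (S τ) g (x τ))
      ((S t).det ^ (-(1 / 2) : ℝ) * (derivWithin g (Set.Ici 0)
        (inner ℝ (x t - m t) ((S t)⁻¹.toEuclideanLin (x t - m t))) *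
          (2 * inner ℝ (x' - m' - A.toEuclideanLin (x t - m t))
            ((S t)⁻¹.toEuclideanLin (x t - m t)))) -
        ellipticDensity (m t) (S t) g (x t) * A.trace) s t := by
  simp_rw [ellipticDensity_eq_inner]
  have hgen := (hg.smooth.differentiableOn (by simp) _
    (inner_inv_nonneg (hpos t ht) (x t - m t))).hasDerivWithinAt
  have hcomp := HasDerivWithinAt.comp t hgen
    (hasDerivWithinAt_inner_inv (hpos t ht) hA (hx.sub hm) hS)
    fun τ hτ => inner_inv_nonneg (hpos τ hτ) (x τ - m τ)
  refine ((hasDerivWithinAt_det_rpow _ (hpos t ht) hS).mul hcomp).congr_deriv ?_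
  simp only [Function.comp_apply, Pi.sub_apply]
  ring

theorem fderiv_ellipticDensity (hg : IsEllipticGenerator d g) {S : Matrix (Fin d) (Fin d) ℝ}
    (hS : S.PosDef) (m x u : EuclideanSpace ℝ (Fin d)) :
    fderiv ℝ (ellipticDensity m S g) x u = S.det ^ (-(1 / 2) : ℝ) *
      (derivWithin g (Set.Ici 0) (inner ℝ (x - m) (S⁻¹.toEuclideanLin (x - m))) *
        (2 * inner ℝ u (S⁻¹.toEuclideanLin (x - m)))) := by
  have hline : HasDerivAt (fun τ : ℝ => x + τ • u) u 0 := by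
    simpa using ((hasDerivAt_id (0 : ℝ)).smul_const u).const_add x
  have halong := hasDerivWithinAt_ellipticDensity_apply (A := 0) hg
    (fun _ _ => hS) (Set.mem_univ 0) Matrix.isHermitian_zero (hasDerivWithinAt_const _ _ m)
    hline.hasDerivWithinAt ((hasDerivWithinAt_const _ _ S).congr_deriv (by simp))
  have hdiff : HasFDerivAt (ellipticDensity m S g) (fderiv ℝ (ellipticDensity m S g) x)
      (x + (0 : ℝ) • u) := by
    simpa using ((contDiff_ellipticDensity hg hS).differentiable (by simp) x).hasFDerivAt
  simpa using (HasFDerivAt.comp_hasDerivAt (f := fun τ => x + τ • u) (0 : ℝ) hdiff hline).unique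
    (hasDerivWithinAt_univ.1 halong)

theorem hasDerivWithinAt_ellipticDensity (hg : IsEllipticGenerator d g)
    (hpos : ∀ τ ∈ s, (S τ).PosDef) (ht : t ∈ s) (hA : A.IsHermitian)
    (hm : HasDerivWithinAt m (A.toEuclideanLin (m t) + b) s t)
    (hS : HasDerivWithinAt S (A * S t + S t * A) s t) (x : EuclideanSpace ℝ (Fin d)) :
    HasDerivWithinAt (fun τ => ellipticDensity (m τ) (S τ) g x)
      (ottoInertia (ellipticDensity (m t) (S t) g) (quadPotential A b) x) s t := by
  refine (hasDerivWithinAt_ellipticDensity_apply hg hpos ht hA hm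
    (hasDerivWithinAt_const t s x) hS).congr_deriv ?_
  have hvelocity : (0 : EuclideanSpace ℝ (Fin d)) - (A.toEuclideanLin (m t) + b) -
      A.toEuclideanLin (x - m t) = -(A.toEuclideanLin x + b) := by
    rw [map_sub]
    abel
  rw [ottoInertia_quadPotential hA
      ((contDiff_ellipticDensity hg (hpos t ht)).differentiable (by simp) x),
    fderiv_ellipticDensity hg (hpos t ht), hvelocity, inner_neg_left]
  ring

end Velocity

section DivergenceFree

variable {d : ℕ} {φ : EuclideanSpace ℝ (Fin d) → ℝ}
  {v : EuclideanSpace ℝ (Fin d) → EuclideanSpace ℝ (Fin d)}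

theorem contDiff_gradient {k : ℕ∞} {f : EuclideanSpace ℝ (Fin d) → ℝ} (hf : ContDiff ℝ (k + 1) f) :
    ContDiff ℝ k (∇ f) :=
  (InnerProductSpace.toDual ℝ (EuclideanSpace ℝ (Fin d))).symm.contDiff.comp
    (hf.fderiv_right le_rfl)

theorem fderiv_ofLp_apply {x : EuclideanSpace ℝ (Fin d)} (hv : DifferentiableAt ℝ v x) (i : Fin d)
    (u : EuclideanSpace ℝ (Fin d)) :
    fderiv ℝ (fun y => (v y).ofLp i) x u = (fderiv ℝ v x u).ofLp i := by
  have hcomp : HasFDerivAt (fun y => (v y).ofLp i)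
      ((EuclideanSpace.proj i : EuclideanSpace ℝ (Fin d) →L[ℝ] ℝ).comp (fderiv ℝ v x)) x :=
    (EuclideanSpace.proj i : EuclideanSpace ℝ (Fin d) →L[ℝ] ℝ).hasFDerivAt.comp x hv.hasFDerivAt
  simp [hcomp.fderiv]

theorem integral_fderiv_apply_eq_neg_integral_mul_divergence (hφ : ContDiff ℝ 1 φ)
    (hc : HasCompactSupport φ) (hv : ContDiff ℝ 1 v) :
    ∫ x, fderiv ℝ φ x (v x) = -∫ x, φ x * divergence v x := by
  have hvi (i) : ContDiff ℝ 1 fun x => (v x).ofLp i := contDiff_euclidean.1 hv i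
  have hint_left (i) : Integrable fun x =>
      fderiv ℝ φ x (EuclideanSpace.single i 1) * (v x).ofLp i :=
    (((hφ.continuous_fderiv one_ne_zero).clm_apply continuous_const).mul
      (hvi i).continuous).integrable_of_hasCompactSupport (hc.fderiv_apply (𝕜 := ℝ) _).mul_right
  have hint_right (i) : Integrable fun x =>
      φ x * fderiv ℝ (fun y => (v y).ofLp i) x (EuclideanSpace.single i 1) :=
    (hφ.continuous.mul (((hvi i).continuous_fderiv one_ne_zero).clm_apply
      continuous_const)).integrable_of_hasCompactSupport hc.mul_right
  have hint_mul (i) : Integrable fun x => φ x * (v x).ofLp i :=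
    (hφ.continuous.mul (hvi i).continuous).integrable_of_hasCompactSupport hc.mul_right
  simp_rw [fun x => apply_eq_sum_single (fderiv ℝ φ x) (v x), divergence, Finset.mul_sum,
    ← fun i x => fderiv_ofLp_apply (hv.differentiable one_ne_zero x) i]
  rw [integral_finsetSum _ fun i _ => hint_left i, integral_finsetSum _ fun i _ => hint_right i,
    ← Finset.sum_neg_distrib]
  refine Finset.sum_congr rfl fun i _ => ?_
  rw [integral_mul_fderiv_eq_neg_fderiv_mul_of_integrable (hint_left i) (hint_right i) (hint_mul i)
    (fun x _ => hφ.differentiable one_ne_zero x)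
    (fun x _ => (hvi i).differentiable one_ne_zero x), neg_neg]

theorem integral_mul_fderiv_apply_of_divergence_eq_zero {χ : EuclideanSpace ℝ (Fin d) → ℝ}
    (hχ : ContDiff ℝ 1 χ) (hc : HasCompactSupport χ) (hφ : ContDiff ℝ 1 φ) (hv : ContDiff ℝ 1 v)
    (hdiv : ∀ x, divergence v x = 0) :
    ∫ x, χ x * fderiv ℝ φ x (v x) = -∫ x, φ x * fderiv ℝ χ x (v x) := by
  have hparts := integral_fderiv_apply_eq_neg_integral_mul_divergence (hχ.mul hφ) hc.mul_right hv
  have hleibniz (x) : fderiv ℝ (fun y => χ y * φ y) x (v x) =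
      χ x * fderiv ℝ φ x (v x) + φ x * fderiv ℝ χ x (v x) := by
    simp [fderiv_fun_mul (hχ.differentiable one_ne_zero x) (hφ.differentiable one_ne_zero x)]
  simp only [hdiv, mul_zero, integral_zero, neg_zero, hleibniz] at hparts
  rw [integral_add] at hparts
  · exact eq_neg_of_add_eq_zero_left hparts
  · exact (hχ.continuous.mul ((hφ.continuous_fderiv one_ne_zero).clm_apply
      hv.continuous)).integrable_of_hasCompactSupport hc.mul_right
  · refine (hφ.continuous.mul ((hχ.continuous_fderiv one_ne_zero).clm_apply
      hv.continuous)).integrable_of_hasCompactSupport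
      ((hc.fderiv (𝕜 := ℝ)).mono fun x hx h0 => hx ?_)
    simp [h0]

theorem exists_cutoff (d : ℕ) : ∃ C : ℝ, ∀ n : ℝ, 0 < n →
    ∃ χ : EuclideanSpace ℝ (Fin d) → ℝ, ContDiff ℝ ∞ χ ∧ HasCompactSupport χ ∧
      (∀ x, 0 ≤ χ x) ∧ (∀ x, ‖x‖ ≤ n → χ x = 1) ∧ ∀ x, ‖fderiv ℝ χ x‖ ≤ C / n := by
  let f : ContDiffBump (0 : EuclideanSpace ℝ (Fin d)) := ⟨1, 2, one_pos, one_lt_two⟩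
  have hf : ContDiff ℝ ∞ f := f.contDiff
  obtain ⟨C, hC⟩ := (hf.continuous_fderiv (by simp)).bounded_above_of_compact_support
    (f.hasCompactSupport.fderiv (𝕜 := ℝ))
  refine ⟨C, fun n hn => ⟨fun x => f (n⁻¹ • x), hf.comp (contDiff_const_smul _),
    f.hasCompactSupport.comp_smul (inv_ne_zero hn.ne'), fun x => f.nonneg, fun x hx => ?_,
    fun x => ?_⟩⟩
  · refine f.one_of_mem_closedBall ?_
    rw [mem_closedBall_zero_iff, norm_smul, norm_inv, Real.norm_of_nonneg hn.le]
    exact inv_mul_le_one_of_le₀ hx hn.le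
  · rw [fderiv_comp_smul, norm_smul, norm_inv, Real.norm_of_nonneg hn.le, div_eq_inv_mul]
    exact mul_le_mul_of_nonneg_left (hC _) (inv_nonneg.2 hn.le)

theorem exists_setIntegral_ball_fderiv_apply_le (hφ : ContDiff ℝ 1 φ) {M : ℝ}
    (hM : ∀ x, |φ x| ≤ M) (hv : ContDiff ℝ 1 v) (hvi : Integrable v)
    (hdiv : ∀ x, divergence v x = 0) (hnonneg : ∀ x, 0 ≤ fderiv ℝ φ x (v x)) :
    ∃ K : ℝ, ∀ n : ℝ, 0 < n → ∫ x in Metric.ball 0 n, fderiv ℝ φ x (v x) ≤ K / n := by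
  obtain ⟨C, hC⟩ := exists_cutoff d
  refine ⟨M * C * ∫ x, ‖v x‖, fun n hn => ?_⟩
  obtain ⟨χ, hχ, hχc, hχ0, hχ1, hχd⟩ := hC n hn
  replace hχ : ContDiff ℝ 1 χ := hχ.of_le (by simp)
  have hint : Integrable fun x => χ x * fderiv ℝ φ x (v x) :=
    (hχ.continuous.mul ((hφ.continuous_fderiv one_ne_zero).clm_apply
      hv.continuous)).integrable_of_hasCompactSupport hχc.mul_right
  have hbound (x) : ‖φ x * fderiv ℝ χ x (v x)‖ ≤ M * (C / n) * ‖v x‖ := by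
    rw [norm_mul, mul_assoc]
    exact mul_le_mul (hM x) ((fderiv ℝ χ x).le_of_opNorm_le (hχd x) (v x)) (norm_nonneg _)
      ((abs_nonneg _).trans (hM x))
  calc ∫ x in Metric.ball 0 n, fderiv ℝ φ x (v x)
      = ∫ x in Metric.ball 0 n, χ x * fderiv ℝ φ x (v x) :=
        setIntegral_congr_fun Metric.isOpen_ball.measurableSet fun x hx => by
          simp [hχ1 x (mem_ball_zero_iff.1 hx).le]
    _ ≤ ∫ x, χ x * fderiv ℝ φ x (v x) :=
        setIntegral_le_integral hint (.of_forall fun x => mul_nonneg (hχ0 x) (hnonneg x))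
    _ ≤ ‖∫ x, φ x * fderiv ℝ χ x (v x)‖ := by
        rw [integral_mul_fderiv_apply_of_divergence_eq_zero hχ hχc hφ hv hdiv]
        exact neg_le_abs _
    _ ≤ ∫ x, M * (C / n) * ‖v x‖ :=
        norm_integral_le_of_norm_le (hvi.norm.const_mul _) (.of_forall hbound)
    _ = M * C * (∫ x, ‖v x‖) / n := by
        rw [integral_const_mul]
        ring

theorem fderiv_apply_eq_zero_of_divergence_eq_zero (hφ : ContDiff ℝ 1 φ) {M : ℝ}
    (hM : ∀ x, |φ x| ≤ M) (hv : ContDiff ℝ 1 v) (hvi : Integrable v)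
    (hdiv : ∀ x, divergence v x = 0) (hnonneg : ∀ x, 0 ≤ fderiv ℝ φ x (v x))
    (x : EuclideanSpace ℝ (Fin d)) : fderiv ℝ φ x (v x) = 0 := by
  obtain ⟨K, hK⟩ := exists_setIntegral_ball_fderiv_apply_le hφ hM hv hvi hdiv hnonneg
  have hcont : Continuous fun x => fderiv ℝ φ x (v x) :=
    (hφ.continuous_fderiv one_ne_zero).clm_apply hv.continuous
  have hint (r : ℝ) : IntegrableOn (fun x => fderiv ℝ φ x (v x)) (Metric.ball 0 r) :=
    (hcont.continuousOn.integrableOn_compact (isCompact_closedBall 0 r)).mono_set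
      Metric.ball_subset_closedBall
  have hzero (r : ℝ) : ∫ x in Metric.ball 0 r, fderiv ℝ φ x (v x) = 0 := by
    refine le_antisymm (ge_of_tendsto (Filter.Tendsto.const_div_atTop Filter.tendsto_id K) ?_)
      (setIntegral_nonneg Metric.isOpen_ball.measurableSet fun x _ => hnonneg x)
    filter_upwards [Filter.eventually_ge_atTop r, Filter.eventually_gt_atTop 0] with n hrn hn
    exact (setIntegral_mono_set (hint n) (.of_forall hnonneg)
      (Metric.ball_subset_ball hrn).eventuallyLE).trans (hK n hn)
  have hae := (setIntegral_eq_zero_iff_of_nonneg_ae (.of_forall hnonneg)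
    (hint (‖x‖ + 1))).1 (hzero _)
  exact Measure.eqOn_open_of_ae_eq hae Metric.isOpen_ball hcont.continuousOn
    continuousOn_const (by simp)

/-- The bounded test function `arctan ∘ h` makes integration by parts legitimate although `h` itself
may grow arbitrarily fast. -/
theorem gradient_eq_zero_of_divergence_eq_zero {ρ h : EuclideanSpace ℝ (Fin d) → ℝ}
    (hρ : ContDiff ℝ 1 ρ) (hpos : ∀ x, 0 < ρ x) (hh : ContDiff ℝ 2 h)
    (hdiv : ∀ x, divergence (fun y => ρ y • ∇ h y) x = 0)
    (hint : Integrable fun x => ρ x • ∇ h x) (x : EuclideanSpace ℝ (Fin d)) :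
    ∇ h x = 0 := by
  have hgrad : ContDiff ℝ 1 (∇ h) := contDiff_gradient (k := 1) hh
  have hderiv (y) : fderiv ℝ (fun z => Real.arctan (h z)) y (ρ y • ∇ h y) =
      (1 + h y ^ 2)⁻¹ * (ρ y * ‖∇ h y‖ ^ 2) := by
    have harctan := (hh.differentiable two_ne_zero y).hasFDerivAt.arctan
    simp [harctan.fderiv, ← inner_gradient_left, mul_left_comm]
  have hflux := fderiv_apply_eq_zero_of_divergence_eq_zero (hh.of_le one_le_two).arctan
    (M := Real.pi / 2) (v := fun y => ρ y • ∇ h y)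
    (fun y => abs_le.2 ⟨(Real.neg_pi_div_two_lt_arctan _).le, (Real.arctan_lt_pi_div_two _).le⟩)
    (hρ.smul hgrad) hint hdiv (fun y => by rw [hderiv]; have := hpos y; positivity) x
  rw [hderiv] at hflux
  simpa [(hpos x).ne', (by positivity : (1 + h x ^ 2) ≠ 0)] using hflux

end DivergenceFree

section Rigidity

open scoped Matrix.Norms.Operator

variable {d : ℕ} {g : ℝ → ℝ}

theorem exists_isHermitian_mul_add_mul_eq {n : Type*} [Fintype n] {S B : Matrix n n ℝ}
    (hS : S.PosDef) (hB : B.IsHermitian) :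
    ∃ A : Matrix n n ℝ, A.IsHermitian ∧ A * S + S * A = B := by
  classical
  let L : Matrix n n ℝ →ₗ[ℝ] Matrix n n ℝ := LinearMap.mulRight ℝ S + LinearMap.mulLeft ℝ S
  have hL (A) : L A = A * S + S * A := rfl
  have hinj : Function.Injective L := by
    rw [← LinearMap.ker_eq_bot, LinearMap.ker_eq_bot']
    intro A hA
    have hsum : (A * S * Aᵀ).trace + (Aᵀ * S * Aᵀᵀ).trace = 0 := by
      rw [Matrix.transpose_transpose, Matrix.mul_assoc Aᵀ, Matrix.trace_mul_comm Aᵀ,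
        ← Matrix.trace_add, ← Matrix.add_mul, ← hL, hA, Matrix.zero_mul, Matrix.trace_zero]
    exact eq_zero_of_trace_mul_mul_transpose_eq_zero hS
      ((add_eq_zero_iff_of_nonneg (trace_mul_mul_transpose_nonneg hS A)
        (trace_mul_mul_transpose_nonneg hS Aᵀ)).1 hsum).1
  obtain ⟨A, hA⟩ := LinearMap.injective_iff_surjective.1 hinj B
  refine ⟨A, hinj ?_, hA⟩
  rw [hA, ← hB.eq, ← hA, hL, hL, Matrix.conjTranspose_add, Matrix.conjTranspose_mul,
    Matrix.conjTranspose_mul, hS.1.eq, add_comm]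

theorem ottoNormSq_ellipticDensity_of_gradient_eq (hg : IsEllipticGenerator d g)
    {S : Matrix (Fin d) (Fin d) ℝ} (hS : S.PosDef) {m : EuclideanSpace ℝ (Fin d)}
    {f : EuclideanSpace ℝ (Fin d) → ℝ} {A : Matrix (Fin d) (Fin d) ℝ}
    {b : EuclideanSpace ℝ (Fin d)} (hf : ∀ x, ∇ f x = A.toEuclideanLin x + b) :
    ottoNormSq (ellipticDensity m S g) f =
      ENNReal.ofReal (‖A.toEuclideanLin m + b‖ ^ 2 + kappa d g * (A * S * Aᵀ).trace) := by
  simp_rw [ottoNormSq, hf]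
  exact lintegral_norm_affine_sq hg hS A b

theorem integrable_smul_gradient_of_ottoNormSq_ne_top {ρ f : EuclideanSpace ℝ (Fin d) → ℝ}
    (hρ : Continuous ρ) (hnonneg : ∀ x, 0 ≤ ρ x) (hint : Integrable ρ) (hf : ContDiff ℝ 1 f)
    (hfin : ottoNormSq ρ f ≠ ⊤) : Integrable fun x => ρ x • ∇ f x := by
  have : IsFiniteMeasure (toMeasure ρ) := isFiniteMeasure_withDensity_ofReal hint.2
  have hgrad : AEStronglyMeasurable (∇ f) (toMeasure ρ) :=
    (contDiff_gradient (k := 0) (by simpa using hf)).continuous.aestronglyMeasurable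
  have hsq : Integrable (fun x => ‖∇ f x‖ ^ 2) (toMeasure ρ) := by
    refine ⟨hgrad.norm.pow 2, ?_⟩
    rw [hasFiniteIntegral_iff_ofReal (.of_forall fun x => sq_nonneg _)]
    exact hfin.lt_top
  have hL1 := ((memLp_two_iff_integrable_sq_norm hgrad).2 hsq).integrable one_le_two
  rw [toMeasure, integrable_withDensity_iff_integrable_smul'
    hρ.measurable.ennreal_ofReal (by simp)] at hL1
  simpa only [ENNReal.toReal_ofReal (hnonneg _)] using hL1

theorem divergence_sub {v w : EuclideanSpace ℝ (Fin d) → EuclideanSpace ℝ (Fin d)}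
    {x : EuclideanSpace ℝ (Fin d)} (hv : DifferentiableAt ℝ v x) (hw : DifferentiableAt ℝ w x) :
    divergence (fun y => v y - w y) x = divergence v x - divergence w x := by
  simp [divergence, fderiv_fun_sub hv hw]

theorem gradient_eq_of_ottoInertia_eq {ρ f q : EuclideanSpace ℝ (Fin d) → ℝ}
    (hρ : ContDiff ℝ 1 ρ) (hpos : ∀ x, 0 < ρ x) (hint : Integrable ρ) (hf : ContDiff ℝ 2 f)
    (hq : ContDiff ℝ 2 q) (hf_fin : ottoNormSq ρ f ≠ ⊤) (hq_fin : ottoNormSq ρ q ≠ ⊤)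
    (heq : ∀ x, ottoInertia ρ f x = ottoInertia ρ q x) (x : EuclideanSpace ℝ (Fin d)) :
    ∇ f x = ∇ q x := by
  have hsub (y) : ∇ (fun z => f z - q z) y = ∇ f y - ∇ q y := by
    rw [gradient, gradient, gradient, fderiv_fun_sub (hf.differentiable two_ne_zero y)
      (hq.differentiable two_ne_zero y), map_sub]
  have hflux {p : EuclideanSpace ℝ (Fin d) → ℝ} (hp : ContDiff ℝ 2 p) :
      Differentiable ℝ fun y => ρ y • ∇ p y :=
    (hρ.smul (contDiff_gradient (k := 1) hp)).differentiable one_ne_zero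
  have hintegrable {p : EuclideanSpace ℝ (Fin d) → ℝ} (hp : ContDiff ℝ 2 p)
      (hfin : ottoNormSq ρ p ≠ ⊤) : Integrable fun y => ρ y • ∇ p y :=
    integrable_smul_gradient_of_ottoNormSq_ne_top hρ.continuous (fun y => (hpos y).le) hint
      (hp.of_le one_le_two) hfin
  rw [← sub_eq_zero, ← hsub]
  refine gradient_eq_zero_of_divergence_eq_zero hρ hpos (hf.sub hq) (fun y => ?_) ?_ x
  · simp_rw [hsub, smul_sub]
    rw [divergence_sub (hflux hf y) (hflux hq y), sub_eq_zero]
    exact neg_injective (heq y)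
  · simp_rw [hsub, smul_sub]
    exact (hintegrable hf hf_fin).sub (hintegrable hq hq_fin)

theorem exists_ottoNormSq_ne_top {γ : ℝ → EuclideanSpace ℝ (Fin d) → ℝ}
    {f : EuclideanSpace ℝ (Fin d) → ℝ}
    (hfin : ∫⁻ t in Set.Icc (0 : ℝ) 1, ENNReal.ofReal t * ottoNormSq (γ t) f ≠ ⊤) :
    ∃ t ∈ Set.Icc (0 : ℝ) 1, ottoNormSq (γ t) f ≠ ⊤ := by
  by_contra! htop
  refine hfin ?_
  have hpos : 0 < ∫⁻ t in Set.Icc (0 : ℝ) 1, ENNReal.ofReal t := by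
    rw [setLIntegral_pos_iff ENNReal.measurable_ofReal]
    refine lt_of_lt_of_le (by simp) (measure_mono (s := Set.Ioc (0 : ℝ) 1) fun t ht => ?_)
    exact ⟨by simpa using ht.1, ht.1.le, ht.2⟩
  calc ∫⁻ t in Set.Icc (0 : ℝ) 1, ENNReal.ofReal t * ottoNormSq (γ t) f
      = ∫⁻ t in Set.Icc (0 : ℝ) 1, ENNReal.ofReal t * ⊤ :=
        setLIntegral_congr_fun measurableSet_Icc fun t ht => by simp only [htop t ht]
    _ = ⊤ := by
        rw [lintegral_mul_const _ ENNReal.measurable_ofReal, ENNReal.mul_top hpos.ne']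

/-- A smooth parametrization, by location and scatter matrix, of a curve of elliptic densities over
`[0, 1]`; nothing is required outside this interval. -/
structure IsEllipticParametrization (g : ℝ → ℝ) (γ : ℝ → EuclideanSpace ℝ (Fin d) → ℝ)
    (m : ℝ → EuclideanSpace ℝ (Fin d)) (S : ℝ → Matrix (Fin d) (Fin d) ℝ) : Prop where
  contDiffOn_location : ContDiffOn ℝ ∞ m (Set.Icc 0 1)
  contDiffOn_scatter : ∀ i j, ContDiffOn ℝ ∞ (fun t => S t i j) (Set.Icc 0 1)
  posDef : ∀ t ∈ Set.Icc (0 : ℝ) 1, (S t).PosDef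
  eq_density : ∀ t ∈ Set.Icc (0 : ℝ) 1, γ t = ellipticDensity (m t) (S t) g

/-- The motion, over `[0, 1]`, of the location and the scatter matrix of an elliptic distribution
transported by the affine velocity field `x ↦ A x + b`, where `A` is symmetric. -/
structure IsAffineMotion (A : Matrix (Fin d) (Fin d) ℝ) (b : EuclideanSpace ℝ (Fin d))
    (m : ℝ → EuclideanSpace ℝ (Fin d)) (S : ℝ → Matrix (Fin d) (Fin d) ℝ) : Prop where
  location : ∀ t ∈ Set.Icc (0 : ℝ) 1,
    HasDerivWithinAt m (A.toEuclideanLin (m t) + b) (Set.Icc 0 1) t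
  scatter : ∀ t ∈ Set.Icc (0 : ℝ) 1,
    HasDerivWithinAt S (A * S t + S t * A) (Set.Icc 0 1) t

variable {γ : ℝ → EuclideanSpace ℝ (Fin d) → ℝ} {f : EuclideanSpace ℝ (Fin d) → ℝ}
  {m : ℝ → EuclideanSpace ℝ (Fin d)} {S : ℝ → Matrix (Fin d) (Fin d) ℝ}

theorem IsEllipticParametrization.exists_isHermitian_hasDerivWithinAt
    (h : IsEllipticParametrization g γ m S) {t : ℝ} (ht : t ∈ Set.Icc (0 : ℝ) 1) :
    ∃ (A : Matrix (Fin d) (Fin d) ℝ) (b : EuclideanSpace ℝ (Fin d)), A.IsHermitian ∧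
      HasDerivWithinAt m (A.toEuclideanLin (m t) + b) (Set.Icc 0 1) t ∧
      HasDerivWithinAt S (A * S t + S t * A) (Set.Icc 0 1) t := by
  let B : Matrix (Fin d) (Fin d) ℝ :=
    Matrix.of fun i j => derivWithin (fun τ => S τ i j) (Set.Icc 0 1) t
  have hB : HasDerivWithinAt S B (Set.Icc 0 1) t := hasDerivWithinAt_matrix_iff.2 fun i j =>
    ((h.contDiffOn_scatter i j).differentiableOn (by simp) t ht).hasDerivWithinAt
  have hB_symm : B.IsHermitian := Matrix.IsHermitian.ext fun i j =>
    derivWithin_congr (fun τ hτ => (h.posDef τ hτ).1.apply i j) ((h.posDef t ht).1.apply i j)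
  obtain ⟨A, hA, hAB⟩ := exists_isHermitian_mul_add_mul_eq (h.posDef t ht) hB_symm
  have hm := (h.contDiffOn_location.differentiableOn (by simp) t ht).hasDerivWithinAt
  exact ⟨A, derivWithin m (Set.Icc 0 1) t - A.toEuclideanLin (m t), hA,
    by rwa [add_sub_cancel], by rwa [hAB]⟩

theorem IsEllipticParametrization.gradient_eq (hg : IsEllipticGenerator d g)
    (h : IsEllipticParametrization g γ m S) (hγ : IsDualGeodesic γ f) {t : ℝ}
    (ht : t ∈ Set.Icc (0 : ℝ) 1) (hfin : ottoNormSq (γ t) f ≠ ⊤)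
    {A : Matrix (Fin d) (Fin d) ℝ} {b : EuclideanSpace ℝ (Fin d)} (hA : A.IsHermitian)
    (hm : HasDerivWithinAt m (A.toEuclideanLin (m t) + b) (Set.Icc 0 1) t)
    (hS : HasDerivWithinAt S (A * S t + S t * A) (Set.Icc 0 1) t)
    (x : EuclideanSpace ℝ (Fin d)) : ∇ f x = A.toEuclideanLin x + b := by
  have hSt := h.posDef t ht
  rw [← gradient_quadPotential hA]
  have hinertia (y) : ottoInertia (γ t) f y = ottoInertia (γ t) (quadPotential A b) y := by
    have hquad := (hasDerivWithinAt_ellipticDensity hg h.posDef ht hA hm hS y).congr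
      (fun τ hτ => congrFun (h.eq_density τ hτ) y) (congrFun (h.eq_density t ht) y)
    rw [← h.eq_density t ht] at hquad
    exact (uniqueDiffOn_Icc zero_lt_one t ht).eq_deriv _ (hγ.hasDeriv t ht y) hquad
  rw [h.eq_density t ht] at hfin hinertia
  refine gradient_eq_of_ottoInertia_eq ((contDiff_ellipticDensity hg hSt).of_le (by simp))
    (ellipticDensity_pos hg hSt) (integrable_ellipticDensity hg hSt)
    (contDiff_infty.1 hγ.smooth_potential 2) (contDiff_quadPotential A b) hfin ?_ hinertia x
  rw [ottoNormSq_ellipticDensity_of_gradient_eq hg hSt (gradient_quadPotential hA b)]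
  exact ENNReal.ofReal_ne_top

theorem IsDualGeodesic.exists_isAffineMotion (hg : IsEllipticGenerator d g)
    (hγ : IsDualGeodesic γ f) (h : IsEllipticParametrization g γ m S)
    (hfin : ∫⁻ t in Set.Icc (0 : ℝ) 1, ENNReal.ofReal t * ottoNormSq (γ t) f ≠ ⊤) :
    ∃ (A : Matrix (Fin d) (Fin d) ℝ) (b : EuclideanSpace ℝ (Fin d)), A.IsHermitian ∧
      (∀ x, ∇ f x = A.toEuclideanLin x + b) ∧ IsAffineMotion A b m S := by
  obtain ⟨t₀, ht₀, hfin₀⟩ := exists_ottoNormSq_ne_top hfin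
  obtain ⟨A, b, hA, hm₀, hS₀⟩ := h.exists_isHermitian_hasDerivWithinAt ht₀
  have hf := h.gradient_eq hg hγ ht₀ hfin₀ hA hm₀ hS₀
  have hmotion : ∀ t ∈ Set.Icc (0 : ℝ) 1,
      HasDerivWithinAt m (A.toEuclideanLin (m t) + b) (Set.Icc 0 1) t ∧
      HasDerivWithinAt S (A * S t + S t * A) (Set.Icc 0 1) t := by
    intro t ht
    obtain ⟨A', b', hA', hm, hS⟩ := h.exists_isHermitian_hasDerivWithinAt ht
    have hfin_t : ottoNormSq (γ t) f ≠ ⊤ := by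
      rw [h.eq_density t ht, ottoNormSq_ellipticDensity_of_gradient_eq hg (h.posDef t ht) hf]
      exact ENNReal.ofReal_ne_top
    have hf' (x) := (hf x).symm.trans (h.gradient_eq hg hγ ht hfin_t hA' hm hS x)
    obtain rfl : b = b' := by simpa using hf' 0
    obtain rfl : A = A' :=
      Matrix.toEuclideanLin.injective (LinearMap.ext fun x => add_right_cancel (hf' x))
    exact ⟨hm, hS⟩
  exact ⟨A, b, hA, hf, fun t ht => (hmotion t ht).1, fun t ht => (hmotion t ht).2⟩

end Rigidity

/-! ### The linear flow generated by a symmetric matrix -/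

section ExpIntegral

/-- The integral `∫₀ᵗ exp (s a) ds`, in closed form. -/
def expIntegral (t a : ℝ) : ℝ :=
  if a = 0 then t else (Real.exp (t * a) - 1) / a

theorem mul_expIntegral (t a : ℝ) : a * expIntegral t a = Real.exp (t * a) - 1 := by
  by_cases ha : a = 0
  · simp [expIntegral, ha]
  · rw [expIntegral, if_neg ha, mul_div_cancel₀ _ ha]

theorem expIntegral_ne_zero {t : ℝ} (ht : t ≠ 0) (a : ℝ) : expIntegral t a ≠ 0 := by
  by_cases ha : a = 0
  · rwa [expIntegral, if_pos ha]
  · rw [expIntegral, if_neg ha]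
    exact div_ne_zero (sub_ne_zero.2 fun h => mul_ne_zero ht ha ((Real.exp_eq_one_iff _).1 h)) ha

theorem hasDerivAt_expIntegral (a t : ℝ) :
    HasDerivAt (fun s => expIntegral s a) (Real.exp (t * a)) t := by
  by_cases ha : a = 0
  · simpa [expIntegral, ha] using hasDerivAt_id' t
  · simp only [expIntegral, ha, if_false]
    have hexp : HasDerivAt (fun s => Real.exp (s * a)) (Real.exp (t * a) * (1 * a)) t :=
      ((hasDerivAt_id t).mul_const a).exp
    refine ((hexp.sub_const 1).div_const a).congr_deriv ?_
    rw [one_mul, mul_div_cancel_right₀ _ ha]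

theorem contDiff_expIntegral {k : WithTop ℕ∞} (a : ℝ) : ContDiff ℝ k fun s => expIntegral s a := by
  by_cases ha : a = 0
  · simpa [expIntegral, ha] using contDiff_fun_id
  · simp only [expIntegral, ha, if_false]
    fun_prop

end ExpIntegral

section Flow

open scoped Matrix.Norms.Operator

variable {n : Type*} [Fintype n] [DecidableEq n] {A : Matrix n n ℝ}

/-- The exponential `exp (t A)` of a symmetric matrix, as a function of time. -/
def flow (A : Matrix n n ℝ) (t : ℝ) : Matrix n n ℝ :=
  cfc (fun a : ℝ => Real.exp (t * a)) A

/-- The integral `∫₀ᵗ exp (s A) ds` of the flow of a symmetric matrix. It takes the initial velocity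
of a point moving along an affine gradient field to its displacement at time `t`. -/
def flowIntegral (A : Matrix n n ℝ) (t : ℝ) : Matrix n n ℝ :=
  cfc (expIntegral t) A

theorem flow_zero (hA : A.IsHermitian) : flow A 0 = 1 := by
  simpa only [flow, zero_mul, Real.exp_zero] using cfc_const_one ℝ A hA.isSelfAdjoint

theorem flow_mul_flow (A : Matrix n n ℝ) (s t : ℝ) : flow A s * flow A t = flow A (s + t) := by
  simp_rw [flow, cfc_mul_cfc, add_mul, Real.exp_add]

theorem flow_mul_flow_neg (hA : A.IsHermitian) (t : ℝ) : flow A t * flow A (-t) = 1 := by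
  rw [flow_mul_flow, add_neg_cancel, flow_zero hA]

theorem flow_neg_mul_flow (hA : A.IsHermitian) (t : ℝ) : flow A (-t) * flow A t = 1 := by
  rw [flow_mul_flow, neg_add_cancel, flow_zero hA]

theorem transpose_flow (A : Matrix n n ℝ) (t : ℝ) : (flow A t)ᵀ = flow A t :=
  transpose_cfc _ _

theorem posDef_flow (hA : A.IsHermitian) (t : ℝ) : (flow A t).PosDef :=
  posDef_cfc hA fun _ _ => Real.exp_pos _

theorem flow_mul_comm (hA : A.IsHermitian) (t : ℝ) : flow A t * A = A * flow A t := by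
  rw [flow, cfc_mul_self hA, self_mul_cfc hA]
  simp_rw [mul_comm]

theorem flowIntegral_zero (A : Matrix n n ℝ) : flowIntegral A 0 = 0 := by
  have hzero : expIntegral 0 = fun _ => 0 := by
    funext a
    simp [expIntegral]
  rw [flowIntegral, hzero, cfc_const_zero]

theorem mul_flowIntegral (hA : A.IsHermitian) (t : ℝ) : A * flowIntegral A t = flow A t - 1 := by
  rw [flowIntegral, self_mul_cfc hA, flow, ← cfc_const_one ℝ A hA.isSelfAdjoint, cfc_sub_cfc]
  simp_rw [mul_expIntegral]

theorem bijective_flowIntegral (hA : A.IsHermitian) {t : ℝ} (ht : t ≠ 0) :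
    Function.Bijective (flowIntegral A t).toEuclideanLin := by
  refine Function.bijective_iff_has_inverse.2
    ⟨(cfc (fun a => (expIntegral t a)⁻¹) A).toEuclideanLin, fun v => ?_, fun v => ?_⟩ <;>
  rw [← toEuclideanLin_mul_apply, flowIntegral, cfc_mul_cfc]
  · simp_rw [inv_mul_cancel₀ (expIntegral_ne_zero ht _)]
    rw [cfc_const_one ℝ A hA.isSelfAdjoint, toEuclideanLin_one_apply]
  · simp_rw [mul_inv_cancel₀ (expIntegral_ne_zero ht _)]
    rw [cfc_const_one ℝ A hA.isSelfAdjoint, toEuclideanLin_one_apply]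

theorem hasDerivAt_flow (hA : A.IsHermitian) (t : ℝ) :
    HasDerivAt (flow A) (A * flow A t) t := by
  rw [flow, self_mul_cfc hA]
  refine hasDerivAt_cfc (F' := fun t a => a * Real.exp (t * a)) hA fun a _ => ?_
  refine ((hasDerivAt_id t).mul_const a).exp.congr_deriv ?_
  rw [one_mul, mul_comm, id]

theorem hasDerivAt_flow_neg (hA : A.IsHermitian) (t : ℝ) :
    HasDerivAt (fun τ => flow A (-τ)) (-(A * flow A (-t))) t :=
  ((hasDerivAt_flow hA (-t)).scomp t (hasDerivAt_neg t)).congr_deriv (neg_one_smul ℝ _)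

theorem hasDerivAt_flowIntegral (hA : A.IsHermitian) (t : ℝ) :
    HasDerivAt (flowIntegral A) (flow A t) t :=
  hasDerivAt_cfc (F' := fun t a => Real.exp (t * a)) hA fun a _ => hasDerivAt_expIntegral a t

theorem contDiff_flow (hA : A.IsHermitian) {k : WithTop ℕ∞} : ContDiff ℝ k (flow A) :=
  contDiff_cfc hA fun _ _ => by fun_prop

theorem contDiff_flowIntegral (hA : A.IsHermitian) {k : WithTop ℕ∞} :
    ContDiff ℝ k (flowIntegral A) :=
  contDiff_cfc hA fun a _ => contDiff_expIntegral a

end Flow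

theorem eq_of_hasDerivWithinAt_zero {E : Type*} [NormedAddCommGroup E] [NormedSpace ℝ E]
    {a b : ℝ} {F : ℝ → E} (h : ∀ t ∈ Set.Icc a b, HasDerivWithinAt F 0 (Set.Icc a b) t)
    {t : ℝ} (ht : t ∈ Set.Icc a b) : F t = F a :=
  constant_of_has_deriv_right_zero (fun τ hτ => (h τ hτ).continuousWithinAt)
    (fun τ hτ => (h τ ⟨hτ.1, hτ.2.le⟩).mono_of_mem_nhdsWithin (Icc_mem_nhdsGE_of_mem hτ)) t ht

section AffineMotion

open scoped Matrix.Norms.Operator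

variable {d : ℕ} {A : Matrix (Fin d) (Fin d) ℝ} {b : EuclideanSpace ℝ (Fin d)}
  {m : ℝ → EuclideanSpace ℝ (Fin d)} {S : ℝ → Matrix (Fin d) (Fin d) ℝ}

theorem IsAffineMotion.scatter_eq (h : IsAffineMotion A b m S) (hA : A.IsHermitian) {t : ℝ}
    (ht : t ∈ Set.Icc (0 : ℝ) 1) : S t = flow A t * S 0 * flow A t := by
  have hderiv : ∀ τ ∈ Set.Icc (0 : ℝ) 1,
      HasDerivWithinAt (fun τ => flow A (-τ) * S τ * flow A (-τ)) 0 (Set.Icc 0 1) τ := by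
    intro τ hτ
    have hflow := (hasDerivAt_flow_neg hA τ).hasDerivWithinAt (s := Set.Icc 0 1)
    refine ((hflow.fun_mul (h.scatter τ hτ)).fun_mul hflow).congr_deriv ?_
    simp only [Matrix.mul_add, Matrix.add_mul, Matrix.neg_mul, Matrix.mul_neg,
      ← Matrix.mul_assoc, flow_mul_comm hA (-τ)]
    abel
  have hconst := eq_of_hasDerivWithinAt_zero hderiv ht
  simp only [neg_zero, flow_zero hA, Matrix.one_mul, Matrix.mul_one] at hconst
  calc S t = (flow A t * flow A (-t)) * S t * (flow A (-t) * flow A t) := by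
        rw [flow_mul_flow_neg hA, flow_neg_mul_flow hA, Matrix.one_mul, Matrix.mul_one]
    _ = flow A t * (flow A (-t) * S t * flow A (-t)) * flow A t := by
        simp only [Matrix.mul_assoc]
    _ = flow A t * S 0 * flow A t := by rw [hconst]

theorem IsAffineMotion.velocity_eq (h : IsAffineMotion A b m S) (hA : A.IsHermitian) {t : ℝ}
    (ht : t ∈ Set.Icc (0 : ℝ) 1) :
    A.toEuclideanLin (m t) + b = (flow A t).toEuclideanLin (A.toEuclideanLin (m 0) + b) := by
  have hderiv : ∀ τ ∈ Set.Icc (0 : ℝ) 1, HasDerivWithinAt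
      (fun τ => (flow A (-τ)).toEuclideanLin (A.toEuclideanLin (m τ) + b)) 0 (Set.Icc 0 1) τ := by
    intro τ hτ
    have hvelocity := (hasDerivWithinAt_toEuclideanLin_apply
      (hasDerivWithinAt_const τ (Set.Icc 0 1) A) (h.location τ hτ)).add_const b
    refine (hasDerivWithinAt_toEuclideanLin_apply (hasDerivAt_flow_neg hA τ).hasDerivWithinAt
      hvelocity).congr_deriv ?_
    rw [map_zero, LinearMap.zero_apply, zero_add, ← toEuclideanLin_mul_apply, flow_mul_comm hA,
      map_neg, LinearMap.neg_apply, neg_add_cancel]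
  have hconst := eq_of_hasDerivWithinAt_zero hderiv ht
  simp only [neg_zero, flow_zero hA, toEuclideanLin_one_apply] at hconst
  rw [← hconst, ← toEuclideanLin_mul_apply, flow_mul_flow_neg hA, toEuclideanLin_one_apply]

theorem IsAffineMotion.location_eq (h : IsAffineMotion A b m S) (hA : A.IsHermitian) {t : ℝ}
    (ht : t ∈ Set.Icc (0 : ℝ) 1) :
    m t = m 0 + (flowIntegral A t).toEuclideanLin (A.toEuclideanLin (m 0) + b) := by
  set v := A.toEuclideanLin (m 0) + b
  have hderiv : ∀ τ ∈ Set.Icc (0 : ℝ) 1, HasDerivWithinAt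
      (fun τ => m τ - (flowIntegral A τ).toEuclideanLin v) 0 (Set.Icc 0 1) τ := by
    intro τ hτ
    refine ((h.location τ hτ).sub (hasDerivWithinAt_toEuclideanLin_apply
      (hasDerivAt_flowIntegral hA τ).hasDerivWithinAt
      (hasDerivWithinAt_const τ _ v))).congr_deriv ?_
    rw [map_zero, add_zero, h.velocity_eq hA hτ, sub_self]
  have hconst := eq_of_hasDerivWithinAt_zero hderiv ht
  simp only [flowIntegral_zero A, map_zero, LinearMap.zero_apply, sub_zero] at hconst
  exact sub_eq_iff_eq_add.1 hconst

theorem isAffineMotion_flow (hA : A.IsHermitian) (m₀ v : EuclideanSpace ℝ (Fin d))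
    (S₀ : Matrix (Fin d) (Fin d) ℝ) :
    IsAffineMotion A (v - A.toEuclideanLin m₀)
      (fun t => m₀ + (flowIntegral A t).toEuclideanLin v)
      (fun t => flow A t * S₀ * flow A t) where
  location t _ := by
    refine ((hasDerivWithinAt_toEuclideanLin_apply (hasDerivAt_flowIntegral hA t).hasDerivWithinAt
      (hasDerivWithinAt_const t _ v)).const_add m₀).congr_deriv ?_
    simp only [map_add, ← toEuclideanLin_mul_apply, mul_flowIntegral hA, map_sub,
      LinearMap.sub_apply, toEuclideanLin_one_apply, map_zero]
    abel
  scatter t _ := by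
    have hflow := hasDerivAt_flow hA t
    refine ((hflow.mul_const S₀).mul hflow).hasDerivWithinAt.congr_deriv ?_
    simp only [Matrix.mul_assoc, flow_mul_comm hA]

end AffineMotion

/-! ### Energy of an affine motion -/

section ExpMoment

/-- The integral `∫₀¹ t exp (2 t a) dt`, which collects the time dependence of the weighted energy
of the flow. -/
def expMoment (a : ℝ) : ℝ := ∫ t in (0 : ℝ)..1, t * Real.exp (2 * t * a)

theorem expMoment_nonneg (a : ℝ) : 0 ≤ expMoment a :=
  intervalIntegral.integral_nonneg zero_le_one fun _ ht => mul_nonneg ht.1 (Real.exp_pos _).le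

theorem expMoment_zero : expMoment 0 = 1 / 2 := by
  simp [expMoment]

theorem sq_mul_expMoment (a : ℝ) :
    a ^ 2 * expMoment a = (2 * a * Real.exp (2 * a) - Real.exp (2 * a) + 1) / 4 := by
  have hprimitive (t : ℝ) : HasDerivAt
      (fun t => (2 * a * t * Real.exp (2 * t * a) - Real.exp (2 * t * a)) / 4)
      (a ^ 2 * (t * Real.exp (2 * t * a))) t := by
    have hexp : HasDerivAt (fun t : ℝ => Real.exp (2 * t * a))
        (Real.exp (2 * t * a) * (2 * 1 * a)) t :=
      (((hasDerivAt_id t).const_mul 2).mul_const a).exp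
    have hlin : HasDerivAt (fun t : ℝ => 2 * a * t) (2 * a * 1) t :=
      (hasDerivAt_id t).const_mul (2 * a)
    refine (((hlin.mul hexp).sub hexp).div_const 4).congr_deriv ?_
    ring
  rw [expMoment, ← intervalIntegral.integral_const_mul,
    intervalIntegral.integral_eq_sub_of_hasDerivAt (fun t _ => hprimitive t)
      (Continuous.intervalIntegrable (by fun_prop) _ _)]
  simp only [mul_one, mul_zero, zero_mul, Real.exp_zero, zero_sub]
  ring

end ExpMoment

section EnergyForm

variable {n : Type*} [Fintype n] [DecidableEq n] {κ : ℝ} {A M S₀ : Matrix n n ℝ}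
  {v : EuclideanSpace ℝ n}

/-- The functional `M ↦ ⟪v, M v⟫ + κ tr (S₀ A M A)`. Its value at `exp (2 t A)` is the squared Otto
norm at time `t` of the affine motion generated by `A`, started with scatter matrix `S₀` and
velocity `v`. -/
def energyForm (κ : ℝ) (A S₀ : Matrix n n ℝ) (v : EuclideanSpace ℝ n) : Matrix n n ℝ →ₗ[ℝ] ℝ :=
  innerₗ (EuclideanSpace ℝ n) v ∘ₗ LinearMap.applyₗ v ∘ₗ Matrix.toEuclideanLin.toLinearMap +
    κ • (Matrix.traceLinearMap n ℝ ℝ ∘ₗ LinearMap.mulLeft ℝ (S₀ * A) ∘ₗ LinearMap.mulRight ℝ A)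

theorem energyForm_apply (κ : ℝ) (A S₀ : Matrix n n ℝ) (v : EuclideanSpace ℝ n)
    (M : Matrix n n ℝ) :
    energyForm κ A S₀ v M = inner ℝ v (M.toEuclideanLin v) + κ * (S₀ * A * (M * A)).trace := rfl

theorem energyForm_transpose_mul_self (hA : A.IsHermitian) (B : Matrix n n ℝ) :
    energyForm κ A S₀ v (Bᵀ * B) =
      ‖B.toEuclideanLin v‖ ^ 2 + κ * (B * A * S₀ * (B * A)ᵀ).trace := by
  rw [energyForm_apply, norm_toEuclideanLin_sq, Matrix.transpose_mul,
    transpose_eq_of_isHermitian hA, Matrix.trace_mul_comm (B * A * S₀), ← Matrix.mul_assoc (A * Bᵀ),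
    Matrix.trace_mul_comm _ S₀]
  simp only [Matrix.mul_assoc]

theorem energyForm_nonneg (hκ : 0 ≤ κ) (hA : A.IsHermitian) (hS₀ : S₀.PosDef)
    (hM : M.PosSemidef) : 0 ≤ energyForm κ A S₀ v M := by
  obtain ⟨B, rfl⟩ := exists_transpose_mul_self_eq hM
  rw [energyForm_transpose_mul_self hA]
  exact add_nonneg (sq_nonneg _) (mul_nonneg hκ (trace_mul_mul_transpose_nonneg hS₀ _))

theorem energyForm_flow (hA : A.IsHermitian) (t : ℝ) :
    energyForm κ A S₀ v (flow A (2 * t)) =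
      ‖(flow A t).toEuclideanLin v‖ ^ 2 + κ * (A * (flow A t * S₀ * flow A t) * Aᵀ).trace := by
  have hsq : flow A (2 * t) = (flow A t)ᵀ * flow A t := by
    rw [transpose_flow, flow_mul_flow, two_mul]
  rw [hsq, energyForm_transpose_mul_self hA, flow_mul_comm hA, Matrix.transpose_mul,
    transpose_flow]
  simp only [Matrix.mul_assoc]

open scoped Matrix.Norms.Operator in
theorem integral_mul_energyForm_flow (hA : A.IsHermitian) :
    ∫ t in (0 : ℝ)..1, t * energyForm κ A S₀ v (flow A (2 * t)) =
      energyForm κ A S₀ v (cfc expMoment A) := by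
  refine Eq.trans ?_ (intervalIntegral_linearMap_cfc (F := fun t a => t * Real.exp (2 * t * a)) hA _
    fun a _ => Continuous.intervalIntegrable (by fun_prop) _ _)
  refine intervalIntegral.integral_congr fun t _ => ?_
  simp only [flow, cfc_const_mul t _ A (continuousOn_spectrum A _), map_smul, smul_eq_mul]

end EnergyForm

section Energy

open scoped Matrix.Norms.Operator

variable {d : ℕ} {g : ℝ → ℝ} {γ : ℝ → EuclideanSpace ℝ (Fin d) → ℝ}
  {f : EuclideanSpace ℝ (Fin d) → ℝ} {m : ℝ → EuclideanSpace ℝ (Fin d)}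
  {S : ℝ → Matrix (Fin d) (Fin d) ℝ} {A : Matrix (Fin d) (Fin d) ℝ} {b : EuclideanSpace ℝ (Fin d)}

theorem IsAffineMotion.ottoNormSq_eq (h : IsAffineMotion A b m S) (hg : IsEllipticGenerator d g)
    (hγ : IsEllipticParametrization g γ m S) (hA : A.IsHermitian)
    (hf : ∀ x, ∇ f x = A.toEuclideanLin x + b) {t : ℝ} (ht : t ∈ Set.Icc (0 : ℝ) 1) :
    ottoNormSq (γ t) f = ENNReal.ofReal
      (energyForm (kappa d g) A (S 0) (A.toEuclideanLin (m 0) + b) (flow A (2 * t))) := by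
  rw [hγ.eq_density t ht, ottoNormSq_ellipticDensity_of_gradient_eq hg (hγ.posDef t ht) hf,
    energyForm_flow hA, h.velocity_eq hA ht, h.scatter_eq hA ht]

theorem IsAffineMotion.lintegral_mul_ottoNormSq (h : IsAffineMotion A b m S)
    (hg : IsEllipticGenerator d g) (hγ : IsEllipticParametrization g γ m S) (hA : A.IsHermitian)
    (hf : ∀ x, ∇ f x = A.toEuclideanLin x + b) :
    ∫⁻ t in Set.Icc (0 : ℝ) 1, ENNReal.ofReal t * ottoNormSq (γ t) f = ENNReal.ofReal
      (energyForm (kappa d g) A (S 0) (A.toEuclideanLin (m 0) + b) (cfc expMoment A)) := by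
  set ℓ := energyForm (kappa d g) A (S 0) (A.toEuclideanLin (m 0) + b)
  have hcont : Continuous fun t => t * ℓ (flow A (2 * t)) :=
    continuous_id.mul (ℓ.continuous_of_finiteDimensional.comp
      ((contDiff_flow hA (k := 0)).continuous.comp (continuous_const_mul 2)))
  have hS₀ := hγ.posDef 0 ⟨le_rfl, zero_le_one⟩
  have hnonneg : ∀ t ∈ Set.Icc (0 : ℝ) 1, 0 ≤ t * ℓ (flow A (2 * t)) := fun t ht =>
    mul_nonneg ht.1 (energyForm_nonneg hg.kappa_pos.le hA hS₀ (posDef_flow hA _).posSemidef)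
  calc ∫⁻ t in Set.Icc (0 : ℝ) 1, ENNReal.ofReal t * ottoNormSq (γ t) f
      = ∫⁻ t in Set.Icc (0 : ℝ) 1, ENNReal.ofReal (t * ℓ (flow A (2 * t))) :=
        setLIntegral_congr_fun measurableSet_Icc fun t ht => by
          rw [h.ottoNormSq_eq hg hγ hA hf ht, ENNReal.ofReal_mul ht.1]
    _ = ENNReal.ofReal (∫ t in Set.Icc (0 : ℝ) 1, t * ℓ (flow A (2 * t))) :=
        (ofReal_integral_eq_lintegral_ofReal hcont.integrableOn_Icc
          (ae_restrict_of_forall_mem measurableSet_Icc hnonneg)).symm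
    _ = ENNReal.ofReal (ℓ (cfc expMoment A)) := by
        rw [integral_Icc_eq_integral_Ioc, ← intervalIntegral.integral_of_le zero_le_one,
          integral_mul_energyForm_flow hA]

end Energy

/-! ### Closed forms -/

section Weights

/-- The scalar function which, applied to `log R`, yields `Q`. At `0` it takes the value `0`,
because `0⁻¹ = 0`. -/
def qWeight (a : ℝ) : ℝ :=
  (Real.exp a - 1)⁻¹ * (2 * a * Real.exp (2 * a) - Real.exp (2 * a) + 1) * (Real.exp a - 1)⁻¹

/-- The scalar function which, applied to `log R`, yields `Q + 2 (log R)^⊥`: the term `1 - a * a⁻¹`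
is the indicator function of `a = 0`. -/
def driftWeight (a : ℝ) : ℝ := qWeight a + 2 * (1 - a * a⁻¹)

theorem qWeight_zero : qWeight 0 = 0 := by
  simp [qWeight]

theorem sub_one_mul_qWeight_mul_sub_one (a : ℝ) :
    (Real.exp a - 1) * qWeight a * (Real.exp a - 1) = a * (4 * expMoment a) * a := by
  by_cases ha : a = 0
  · simp [ha]
  · have hexp : Real.exp a - 1 ≠ 0 := sub_ne_zero.2 fun h => ha ((Real.exp_eq_one_iff a).1 h)
    rw [qWeight, show a * (4 * expMoment a) * a = 4 * (a ^ 2 * expMoment a) by ring,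
      sq_mul_expMoment]
    field_simp

theorem expIntegral_mul_driftWeight_mul_expIntegral (a : ℝ) :
    expIntegral 1 a * driftWeight a * expIntegral 1 a = 4 * expMoment a := by
  by_cases ha : a = 0
  · norm_num [ha, driftWeight, qWeight_zero, expIntegral, expMoment_zero]
  · have hweight : driftWeight a = qWeight a := by
      rw [driftWeight, mul_inv_cancel₀ ha, sub_self, mul_zero, add_zero]
    have hintegral : a * expIntegral 1 a = Real.exp a - 1 := by rw [mul_expIntegral, one_mul]
    refine mul_left_cancel₀ (mul_ne_zero ha ha) ?_
    calc a * a * (expIntegral 1 a * driftWeight a * expIntegral 1 a)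
        = (a * expIntegral 1 a) * driftWeight a * (a * expIntegral 1 a) := by ring
      _ = a * (4 * expMoment a) * a := by
          rw [hintegral, hweight, sub_one_mul_qWeight_mul_sub_one]
      _ = a * a * (4 * expMoment a) := by ring

theorem driftWeight_nonneg (a : ℝ) : 0 ≤ driftWeight a := by
  refine nonneg_of_mul_nonneg_left ?_ (mul_self_pos.2 (expIntegral_ne_zero one_ne_zero a))
  calc 0 ≤ 4 * expMoment a := mul_nonneg zero_le_four (expMoment_nonneg a)
    _ = driftWeight a * (expIntegral 1 a * expIntegral 1 a) := by
        rw [← expIntegral_mul_driftWeight_mul_expIntegral]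
        ring

theorem qWeight_nonneg (a : ℝ) : 0 ≤ qWeight a := by
  by_cases ha : a = 0
  · rw [ha, qWeight_zero]
  · simpa [driftWeight, ha] using driftWeight_nonneg a

end Weights

section ClosedForms

variable {d : ℕ} {κ : ℝ} {A S₀ S₁ Q R : Matrix (Fin d) (Fin d) ℝ} {v : EuclideanSpace ℝ (Fin d)}

theorem flow_one (A : Matrix (Fin d) (Fin d) ℝ) : flow A 1 = cfc Real.exp A := by
  simp only [flow, one_mul]

theorem logm_flow_one (hA : A.IsHermitian) : logm (flow A 1) = A := by
  rw [flow_one, logm, cfc_cfc _ _ hA]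
  simp_rw [Real.log_exp]
  exact cfc_id' ℝ A hA.isSelfAdjoint

theorem exists_flow_one_eq (hR : R.PosDef) :
    ∃ A : Matrix (Fin d) (Fin d) ℝ, A.IsHermitian ∧ flow A 1 = R := by
  refine ⟨logm R, isHermitian_cfc _ _, ?_⟩
  calc flow (logm R) 1 = cfc (fun x => Real.exp (Real.log x)) R := by
        rw [flow_one, logm, cfc_cfc _ _ hR.isHermitian]
    _ = cfc (fun x => x) R := cfc_congr fun x hx => Real.exp_log (spectrum_pos_of_posDef hR hx)
    _ = R := cfc_id' ℝ R hR.isHermitian.isSelfAdjoint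

theorem flow_one_sq (A : Matrix (Fin d) (Fin d) ℝ) :
    flow A 1 ^ 2 = cfc (fun a => Real.exp (2 * a)) A := by
  rw [sq, flow_mul_flow, one_add_one_eq_two, flow]

theorem logm_flow_one_sq (hA : A.IsHermitian) :
    logm (flow A 1 ^ 2) = cfc (fun a : ℝ => 2 * a) A := by
  rw [flow_one_sq, logm, cfc_cfc _ _ hA]
  simp_rw [Real.log_exp]

theorem logm_mul_sq_sub_sq_add_one (hA : A.IsHermitian) :
    logm (flow A 1 ^ 2) * flow A 1 ^ 2 - flow A 1 ^ 2 + 1 =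
      cfc (fun a => 2 * a * Real.exp (2 * a) - Real.exp (2 * a) + 1) A := by
  rw [logm_flow_one_sq hA, flow_one_sq, cfc_mul_cfc, cfc_sub_cfc,
    ← cfc_const_one ℝ A hA.isSelfAdjoint, cfc_add_cfc]

theorem flow_one_sub_one (hA : A.IsHermitian) :
    flow A 1 - 1 = cfc (fun a => Real.exp a - 1) A := by
  rw [flow_one, ← cfc_const_one ℝ A hA.isSelfAdjoint, cfc_sub_cfc]

theorem qMatrix_flow_one (hA : A.IsHermitian) : qMatrix (flow A 1) = cfc qWeight A := by
  rw [qMatrix, logm_mul_sq_sub_sq_add_one hA, flow_one_sub_one hA, pinv, cfc_cfc _ _ hA,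
    cfc_mul_cfc, cfc_mul_cfc]
  rfl

theorem posSemidef_qMatrix (hR : R.PosDef) : (qMatrix R).PosSemidef := by
  obtain ⟨A, hA, rfl⟩ := exists_flow_one_eq hR
  rw [qMatrix_flow_one hA]
  exact posSemidef_cfc fun a _ => qWeight_nonneg a

theorem perp_eq_cfc (hA : A.IsHermitian) : perp A = cfc (fun a : ℝ => 1 - a * a⁻¹) A := by
  rw [perp, pinv, self_mul_cfc hA, ← cfc_const_one ℝ A hA.isSelfAdjoint, cfc_sub_cfc]

theorem qMatrix_add_two_perp (hA : A.IsHermitian) :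
    qMatrix (flow A 1) + 2 • perp (logm (flow A 1)) = cfc driftWeight A := by
  rw [logm_flow_one hA, qMatrix_flow_one hA, perp_eq_cfc hA, two_smul, cfc_add_cfc, cfc_add_cfc]
  simp_rw [← two_mul]
  rfl

theorem mulVecNorm_sqrtm_sq (hQ : Q.PosSemidef) (x : EuclideanSpace ℝ (Fin d)) :
    mulVecNorm (sqrtm Q) x ^ 2 = inner ℝ x (Q.toEuclideanLin x) := by
  rw [mulVecNorm, norm_toEuclideanLin_sq, transpose_sqrtm, sqrtm_mul_self hQ]

theorem mulVecNorm_flowIntegral_sq (hA : A.IsHermitian) (v : EuclideanSpace ℝ (Fin d)) :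
    mulVecNorm (sqrtm (qMatrix (flow A 1) + 2 • perp (logm (flow A 1))))
        ((flowIntegral A 1).toEuclideanLin v) ^ 2 =
      4 * inner ℝ v ((cfc expMoment A).toEuclideanLin v) := by
  rw [qMatrix_add_two_perp hA, mulVecNorm_sqrtm_sq (posSemidef_cfc fun a _ => driftWeight_nonneg a),
    inner_toEuclideanLin_left, flowIntegral, transpose_cfc, ← toEuclideanLin_mul_apply,
    ← toEuclideanLin_mul_apply, cfc_mul_cfc, cfc_mul_cfc]
  simp_rw [expIntegral_mul_driftWeight_mul_expIntegral]
  rw [cfc_const_mul 4 expMoment A (continuousOn_spectrum A _), map_smul, LinearMap.smul_apply,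
    inner_smul_right]

theorem logm_mul_sq_sub_sq_add_one_eq_smul (hA : A.IsHermitian) :
    logm (flow A 1 ^ 2) * flow A 1 ^ 2 - flow A 1 ^ 2 + 1 =
      (4 : ℝ) • (A * (cfc expMoment A * A)) := by
  rw [logm_mul_sq_sub_sq_add_one hA, cfc_mul_self hA, self_mul_cfc hA,
    ← cfc_const_mul 4 _ A (continuousOn_spectrum A _)]
  refine cfc_congr fun a _ => ?_
  linear_combination -4 * sq_mul_expMoment a

theorem sub_one_mul_qMatrix_mul_sub_one (hA : A.IsHermitian) :
    (flow A 1 - 1) * qMatrix (flow A 1) * (flow A 1 - 1) =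
      (4 : ℝ) • (A * (cfc expMoment A * A)) := by
  rw [qMatrix_flow_one hA, flow_one_sub_one hA, cfc_mul_cfc, cfc_mul_cfc, cfc_mul_self hA,
    self_mul_cfc hA, ← cfc_const_mul 4 _ A (continuousOn_spectrum A _)]
  refine cfc_congr fun a _ => ?_
  linear_combination sub_one_mul_qWeight_mul_sub_one a

theorem trace_sub_add_eq (hA : A.IsHermitian) (S₀ : Matrix (Fin d) (Fin d) ℝ) :
    (S₀ - flow A 1 * S₀ * flow A 1 + S₀ * flow A 1 ^ 2 * logm (flow A 1 ^ 2)).trace =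
      4 * (S₀ * A * (cfc expMoment A * A)).trace := by
  have hcycle : (flow A 1 * S₀ * flow A 1).trace = (S₀ * flow A 1 ^ 2).trace := by
    rw [Matrix.mul_assoc, Matrix.trace_mul_comm, Matrix.mul_assoc, sq]
  have hcomm : flow A 1 ^ 2 * logm (flow A 1 ^ 2) = logm (flow A 1 ^ 2) * flow A 1 ^ 2 := by
    rw [logm_flow_one_sq hA, flow_one_sq, cfc_mul_cfc, cfc_mul_cfc]
    simp_rw [mul_comm]
  calc (S₀ - flow A 1 * S₀ * flow A 1 + S₀ * flow A 1 ^ 2 * logm (flow A 1 ^ 2)).trace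
      = (S₀ * (logm (flow A 1 ^ 2) * flow A 1 ^ 2 - flow A 1 ^ 2 + 1)).trace := by
        rw [Matrix.trace_add, Matrix.trace_sub, hcycle, Matrix.mul_assoc S₀, hcomm, Matrix.mul_add,
          Matrix.mul_sub, Matrix.mul_one, Matrix.trace_add, Matrix.trace_sub]
        ring
    _ = 4 * (S₀ * A * (cfc expMoment A * A)).trace := by
        rw [logm_mul_sq_sub_sq_add_one_eq_smul hA, Matrix.mul_smul, Matrix.trace_smul, smul_eq_mul,
          Matrix.mul_assoc S₀]

theorem frobeniusNorm_sq (B : Matrix (Fin d) (Fin d) ℝ) :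
    frobeniusNorm B ^ 2 = (Bᵀ * B).trace := by
  rw [frobeniusNorm, Real.sq_sqrt (by positivity), Finset.sum_comm]
  simp only [Matrix.trace, Matrix.diag_apply, Matrix.mul_apply, Matrix.transpose_apply, sq]

theorem frobeniusNorm_sqrtm_mul_sq (hQ : Q.PosSemidef) (B : Matrix (Fin d) (Fin d) ℝ) :
    frobeniusNorm (sqrtm Q * B) ^ 2 = (Bᵀ * Q * B).trace := by
  rw [frobeniusNorm_sq, Matrix.transpose_mul, transpose_sqrtm, Matrix.mul_assoc,
    ← Matrix.mul_assoc (sqrtm Q), sqrtm_mul_self hQ, ← Matrix.mul_assoc]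

theorem frobeniusNorm_sqrtm_qMatrix_mul_sq (hA : A.IsHermitian) (h₀ : S₀.PosDef)
    (h₁ : flow A 1 * sqrtm S₀ = sqrtm S₁) :
    frobeniusNorm (sqrtm (qMatrix (flow A 1)) * (sqrtm S₁ - sqrtm S₀)) ^ 2 =
      4 * (S₀ * A * (cfc expMoment A * A)).trace := by
  have hsub : sqrtm S₁ - sqrtm S₀ = (flow A 1 - 1) * sqrtm S₀ := by
    rw [Matrix.sub_mul, h₁, Matrix.one_mul]
  have htranspose : ((flow A 1 - 1) * sqrtm S₀)ᵀ = sqrtm S₀ * (flow A 1 - 1) := by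
    rw [Matrix.transpose_mul, Matrix.transpose_sub, transpose_flow, Matrix.transpose_one,
      transpose_sqrtm]
  calc frobeniusNorm (sqrtm (qMatrix (flow A 1)) * (sqrtm S₁ - sqrtm S₀)) ^ 2
      = (sqrtm S₀ * ((flow A 1 - 1) * qMatrix (flow A 1) * (flow A 1 - 1) * sqrtm S₀)).trace := by
        rw [frobeniusNorm_sqrtm_mul_sq (posSemidef_qMatrix (posDef_flow hA 1)), hsub, htranspose]
        simp only [Matrix.mul_assoc]
    _ = (S₀ * ((flow A 1 - 1) * qMatrix (flow A 1) * (flow A 1 - 1))).trace := by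
        rw [Matrix.trace_mul_comm, Matrix.mul_assoc, sqrtm_mul_self h₀.posSemidef,
          Matrix.trace_mul_comm]
    _ = 4 * (S₀ * A * (cfc expMoment A * A)).trace := by
        rw [sub_one_mul_qMatrix_mul_sub_one hA, Matrix.mul_smul, Matrix.trace_smul, smul_eq_mul,
          Matrix.mul_assoc S₀]

theorem energyForm_cfc_expMoment (hA : A.IsHermitian) :
    energyForm κ A S₀ v (cfc expMoment A) =
      κ / 4 * (S₀ - flow A 1 * S₀ * flow A 1 +
        S₀ * flow A 1 ^ 2 * logm (flow A 1 ^ 2)).trace +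
      1 / 4 * mulVecNorm (sqrtm (qMatrix (flow A 1) + 2 • perp (logm (flow A 1))))
        ((flowIntegral A 1).toEuclideanLin v) ^ 2 := by
  rw [energyForm_apply, trace_sub_add_eq hA, mulVecNorm_flowIntegral_sq hA]
  ring

theorem energyForm_cfc_expMoment_of_mul_sqrtm_eq (hA : A.IsHermitian) (h₀ : S₀.PosDef)
    (h₁ : flow A 1 * sqrtm S₀ = sqrtm S₁) :
    energyForm κ A S₀ v (cfc expMoment A) =
      κ / 4 * frobeniusNorm (sqrtm (qMatrix (flow A 1)) * (sqrtm S₁ - sqrtm S₀)) ^ 2 +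
      1 / 4 * mulVecNorm (sqrtm (qMatrix (flow A 1) + 2 • perp (logm (flow A 1))))
        ((flowIntegral A 1).toEuclideanLin v) ^ 2 := by
  rw [energyForm_apply, frobeniusNorm_sqrtm_qMatrix_mul_sq hA h₀ h₁, mulVecNorm_flowIntegral_sq hA]
  ring

end ClosedForms

/-! ### Evaluation of the divergence -/

section Evaluation

open scoped Matrix.Norms.Operator

variable {d : ℕ} {g : ℝ → ℝ} {γ : ℝ → EuclideanSpace ℝ (Fin d) → ℝ}
  {f : EuclideanSpace ℝ (Fin d) → ℝ} {m : ℝ → EuclideanSpace ℝ (Fin d)}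
  {S : ℝ → Matrix (Fin d) (Fin d) ℝ} {A B S₀ : Matrix (Fin d) (Fin d) ℝ}
  {b m₀ v : EuclideanSpace ℝ (Fin d)}

theorem isEllipticParametrization_flow (hA : A.IsHermitian) (hS₀ : S₀.PosDef) (g : ℝ → ℝ)
    (m₀ v : EuclideanSpace ℝ (Fin d)) :
    IsEllipticParametrization g
      (fun t => ellipticDensity (m₀ + (flowIntegral A t).toEuclideanLin v)
        (flow A t * S₀ * flow A t) g)
      (fun t => m₀ + (flowIntegral A t).toEuclideanLin v) (fun t => flow A t * S₀ * flow A t) where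
  contDiffOn_location :=
    (contDiff_const.add ((LinearMap.toContinuousLinearMap (LinearMap.applyₗ v ∘ₗ
      Matrix.toEuclideanLin.toLinearMap)).contDiff.comp (contDiff_flowIntegral hA))).contDiffOn
  contDiffOn_scatter i j :=
    ((LinearMap.toContinuousLinearMap (Matrix.entryLinearMap ℝ ℝ i j)).contDiff.comp
      (((contDiff_flow hA).mul contDiff_const).mul (contDiff_flow hA))).contDiffOn
  posDef t _ := posDef_mul_mul hS₀ (posDef_flow hA t)
  eq_density _ _ := rfl

theorem IsAffineMotion.isDualGeodesic (h : IsAffineMotion A b m S) (hg : IsEllipticGenerator d g)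
    (hγ : IsEllipticParametrization g γ m S) (hA : A.IsHermitian) :
    IsDualGeodesic γ (quadPotential A b) where
  mem t ht := by
    rw [hγ.eq_density t ht]
    exact ellipticDensity_mem_densityManifold hg (hγ.posDef t ht)
  smooth_potential := contDiff_quadPotential A b
  hasDeriv t ht x := by
    rw [hγ.eq_density t ht]
    exact (hasDerivWithinAt_ellipticDensity hg hγ.posDef ht hA (h.location t ht)
      (h.scatter t ht) x).congr_of_mem (fun τ hτ => by rw [hγ.eq_density τ hτ]) ht

theorem IsEllipticParametrization.wklDivergence_le (hγ : IsEllipticParametrization g γ m S)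
    (hf : IsDualGeodesic γ f) :
    wklDivergence g (toMeasure (γ 0)) (toMeasure (γ 1)) ≤
      ∫⁻ t in Set.Icc (0 : ℝ) 1, ENNReal.ofReal t * ottoNormSq (γ t) f :=
  sInf_le ⟨γ, ⟨m, S, hγ.contDiffOn_location, hγ.contDiffOn_scatter,
    fun t ht => ⟨hγ.posDef t ht, hγ.eq_density t ht⟩⟩, f, hf, rfl, rfl, rfl⟩

theorem wklDivergence_flow_le (hg : IsEllipticGenerator d g) (hA : A.IsHermitian)
    (hS₀ : S₀.PosDef) (m₀ v : EuclideanSpace ℝ (Fin d)) :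
    wklDivergence g (toMeasure (ellipticDensity m₀ S₀ g))
        (toMeasure (ellipticDensity (m₀ + (flowIntegral A 1).toEuclideanLin v)
          (flow A 1 * S₀ * flow A 1) g)) ≤
      ENNReal.ofReal (energyForm (kappa d g) A S₀ v (cfc expMoment A)) := by
  have hmotion := isAffineMotion_flow hA m₀ v S₀
  have hγ := isEllipticParametrization_flow hA hS₀ g m₀ v
  have hle := hγ.wklDivergence_le (hmotion.isDualGeodesic hg hγ hA)
  rw [hmotion.lintegral_mul_ottoNormSq hg hγ hA (gradient_quadPotential hA _)] at hle
  simpa only [flowIntegral_zero, flow_zero hA, map_zero, LinearMap.zero_apply, add_zero,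
    Matrix.one_mul, Matrix.mul_one, add_sub_cancel] using hle

theorem eq_of_flow_one_mul_mul_eq (hA : A.IsHermitian) (hB : B.IsHermitian)
    (hS₀ : S₀.PosDef) (h : flow A 1 * S₀ * flow A 1 = flow B 1 * S₀ * flow B 1) : A = B := by
  rw [← logm_flow_one hA, eq_transportMatrix hS₀ (posDef_flow hA 1) h,
    ← eq_transportMatrix hS₀ (posDef_flow hB 1) rfl, logm_flow_one hB]

theorem IsDualGeodesic.lintegral_mul_ottoNormSq_eq (hf : IsDualGeodesic γ f)
    (hg : IsEllipticGenerator d g) (hγ : IsEllipticParametrization g γ m S)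
    (hfin : ∫⁻ t in Set.Icc (0 : ℝ) 1, ENNReal.ofReal t * ottoNormSq (γ t) f ≠ ⊤)
    (hA : A.IsHermitian) (hm : m 1 = m 0 + (flowIntegral A 1).toEuclideanLin v)
    (hS : S 1 = flow A 1 * S 0 * flow A 1) :
    ∫⁻ t in Set.Icc (0 : ℝ) 1, ENNReal.ofReal t * ottoNormSq (γ t) f =
      ENNReal.ofReal (energyForm (kappa d g) A (S 0) v (cfc expMoment A)) := by
  obtain ⟨B, b, hB, hgrad, hmotion⟩ := hf.exists_isAffineMotion hg hγ hfin
  have hone : (1 : ℝ) ∈ Set.Icc (0 : ℝ) 1 := ⟨zero_le_one, le_rfl⟩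
  obtain rfl : B = A := eq_of_flow_one_mul_mul_eq hB hA (hγ.posDef 0 ⟨le_rfl, zero_le_one⟩)
    ((hmotion.scatter_eq hB hone).symm.trans hS)
  obtain rfl : B.toEuclideanLin (m 0) + b = v :=
    (bijective_flowIntegral hB one_ne_zero).injective
      (add_left_cancel ((hmotion.location_eq hB hone).symm.trans hm))
  exact hmotion.lintegral_mul_ottoNormSq hg hγ hB hgrad

theorem wklDivergence_flow (hg : IsEllipticGenerator d g) (hA : A.IsHermitian)
    (hS₀ : S₀.PosDef) (m₀ v : EuclideanSpace ℝ (Fin d)) :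
    wklDivergence g (toMeasure (ellipticDensity m₀ S₀ g))
        (toMeasure (ellipticDensity (m₀ + (flowIntegral A 1).toEuclideanLin v)
          (flow A 1 * S₀ * flow A 1) g)) =
      ENNReal.ofReal (energyForm (kappa d g) A S₀ v (cfc expMoment A)) := by
  refine le_antisymm (wklDivergence_flow_le hg hA hS₀ m₀ v) (le_sInf ?_)
  rintro _ ⟨γ, ⟨m, S, hm, hS, hγ⟩, f, hf, hstart, hend, rfl⟩
  have hparam : IsEllipticParametrization g γ m S :=
    ⟨hm, hS, fun t ht => (hγ t ht).1, fun t ht => (hγ t ht).2⟩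
  have hzero : (0 : ℝ) ∈ Set.Icc (0 : ℝ) 1 := ⟨le_rfl, zero_le_one⟩
  have hone : (1 : ℝ) ∈ Set.Icc (0 : ℝ) 1 := ⟨zero_le_one, le_rfl⟩
  rw [hparam.eq_density 0 hzero] at hstart
  rw [hparam.eq_density 1 hone] at hend
  obtain ⟨rfl, rfl⟩ := elliptic_injective hg (hparam.posDef 0 hzero) hS₀ hstart
  obtain ⟨hm₁, hS₁⟩ := elliptic_injective hg (hparam.posDef 1 hone)
    (posDef_mul_mul hS₀ (posDef_flow hA 1)) hend
  by_cases hfin : ∫⁻ t in Set.Icc (0 : ℝ) 1, ENNReal.ofReal t * ottoNormSq (γ t) f = ⊤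
  · rw [hfin]
    exact le_top
  · exact (hf.lintegral_mul_ottoNormSq_eq hg hparam hfin hA hm₁ hS₁).ge

theorem toReal_wklDivergence_flow (hg : IsEllipticGenerator d g) (hA : A.IsHermitian)
    (hS₀ : S₀.PosDef) (m₀ v : EuclideanSpace ℝ (Fin d)) :
    (wklDivergence g (toMeasure (ellipticDensity m₀ S₀ g))
        (toMeasure (ellipticDensity (m₀ + (flowIntegral A 1).toEuclideanLin v)
          (flow A 1 * S₀ * flow A 1) g))).toReal =
      energyForm (kappa d g) A S₀ v (cfc expMoment A) := by
  rw [wklDivergence_flow hg hA hS₀, ENNReal.toReal_ofReal]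
  exact energyForm_nonneg hg.kappa_pos.le hA hS₀ (posSemidef_cfc fun a _ => expMoment_nonneg a)

end Evaluation

end WKL

end

theorem mainTheorem2 {d : ℕ} (hd : 0 < d) (g : ℝ → ℝ)
    (m₀ m₁ : EuclideanSpace ℝ (Fin d)) (S₀ S₁ : Matrix (Fin d) (Fin d) ℝ)
    (μ ν : MeasureTheory.Measure (EuclideanSpace ℝ (Fin d)))
    (hμ : WKL.IsElliptic μ m₀ S₀ g) (hν : WKL.IsElliptic ν m₁ S₁ g)
    (R Q : Matrix (Fin d) (Fin d) ℝ)
    (hR : R = WKL.transportMatrix S₀ S₁) (hQ : Q = WKL.qMatrix R) :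
    WKL.wklDivergence g μ ν ≠ ⊤ ∧
    (WKL.wklDivergence g μ ν).toReal =
      WKL.kappa d g / 4 * (S₀ - S₁ + S₀ * R ^ 2 * WKL.logm (R ^ 2)).trace +
      1 / 4 * WKL.mulVecNorm (WKL.sqrtm (Q + 2 • WKL.perp (WKL.logm R))) (m₁ - m₀) ^ 2 ∧
    (S₀ * S₁ = S₁ * S₀ →
      (WKL.wklDivergence g μ ν).toReal =
        WKL.kappa d g / 4 *
          WKL.frobeniusNorm (WKL.sqrtm Q * (WKL.sqrtm S₁ - WKL.sqrtm S₀)) ^ 2 +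
        1 / 4 * WKL.mulVecNorm (WKL.sqrtm (Q + 2 • WKL.perp (WKL.logm R))) (m₁ - m₀) ^ 2) := by
  obtain ⟨hg, hS₀, rfl⟩ := hμ
  obtain ⟨-, hS₁, rfl⟩ := hν
  obtain ⟨A, hA, hAR⟩ := WKL.exists_flow_one_eq (WKL.posDef_transportMatrix hS₀ hS₁)
  obtain ⟨v, hv⟩ := (WKL.bijective_flowIntegral hA one_ne_zero).surjective (m₁ - m₀)
  have hm : m₀ + (WKL.flowIntegral A 1).toEuclideanLin v = m₁ := by rw [hv, add_sub_cancel]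
  have hS : WKL.flow A 1 * S₀ * WKL.flow A 1 = S₁ := by
    rw [hAR, WKL.transportMatrix_mul_mul hS₀ hS₁]
  have hdiv := WKL.wklDivergence_flow hg hA hS₀ m₀ v
  have hreal := WKL.toReal_wklDivergence_flow hg hA hS₀ m₀ v
  rw [hm, hS] at hdiv hreal
  rw [hQ, hR, ← hAR, ← hv, hreal]
  refine ⟨hdiv ▸ ENNReal.ofReal_ne_top, ?_, fun hcomm => ?_⟩
  · rw [WKL.energyForm_cfc_expMoment hA, hS]
  · refine WKL.energyForm_cfc_expMoment_of_mul_sqrtm_eq hA hS₀ ?_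
    rw [hAR, WKL.transportMatrix_mul_sqrtm_of_commute hS₀ hS₁ hcomm]
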